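/- Let $d\ge 1$, let $X_1,X_2,\dots$ be i.i.d. observations with values in a measurable space, let $Z_m$ be an estimator (a measurable function of $m$ observations) with values in $\mathbb R^d$, and let $\theta_0\in\mathbb R^d$. Suppose that $a_n(Z_n(X_1,\dots,X_n)-\theta_0)\to Y=(Y_1,\dots,Y_d)$ in distribution, for some numbers $a_n\ge 0$ with $a_n\to\infty$. Let $\alpha=(\alpha_1,\dots,\alpha_d)\in(0,1)^d$, let $F_i$ be the distribution function of $Y_i$ and $q_i=F_i^{-1}(\alpha_i)=\inf\{x:F_i(x)\ge\alpha_i\}$, and suppose that $Y_i$ has a density $f_i$ that is continuous and strictly positive at $q_i$, for $i=1,\dots,d$. Put $q=(q_1,\dots,q_d)$. Let $c>0$ and $\beta\in(0,1)$. Divide the sample of size $n$ into $\lfloor cn^\beta\rfloor$ blocks of $\lfloor n/(cn^\beta)\rfloor$ observations each. Suppose that at most $l_n$ of the $n$ observations have been replaced by arbitrary random variables, where $l_n=O(n^\gamma)$ for a real number $\gamma$. Let $\tilde Z^{(j)}_n$ be the estimate computed from the $j$-th block of the contaminated sample (a random vector; if the block contains contaminated observations, $\tilde Z^{(j)}_n$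 may be any random vector). Let $T_n\in\mathbb R^d$ be their component-wise quantile: the $i$-th coordinate of $T_n$ is $\frac12(\tilde x_{\lceil k\alpha_i\rceil}+\tilde x_{\lfloor k\alpha_i+1\rfloor})$, where $k=\lfloor cn^\beta\rfloor$ and $\tilde x_1\le\dots\le\tilde x_k$ are the $i$-th coordinates of the $\tilde Z^{(j)}_n$ in increasing order. For $b\in(0,1)$ let $F_{n,i}^{(b)}$ be the distribution function of the $i$-th coordinate of $a_m(Z_m(X_1,\dots,X_m)-\theta_0)$ with $m=\lfloor n/(cn^{b})\rfloor$, and let $S_i$ be the set of $b\in(0,1)$ such that, for every $y\in\mathbb R$, $$\lim_{n\to\infty}\sqrt{n^{b}}\,\bigl(F_i(x_n)-F_{n,i}^{(b)}(x_n)\bigr)=0,\qquad x_n=q_i+\frac{y}{\sqrt{\lfloor n^{b}\rfloor}}.$$ Let $\beta_i^*=\sup\{\beta'\in(0,1):(0,\beta']\subset S_i\}$ (with $\sup\emptyset=0$), which is $\sup S_i$ whenever $S_i$ is an interval with left endpoint $0$. (1) If $\beta>\gamma$, then $a_{\lfloor n/(cn^\beta)\rfloor}(T_n-\theta_0)\to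 q$ in probability as $n\to\infty$. (2) If $2\gamma<\beta<\min_{i}\beta_i^*$, then $$\sqrt{cn^\beta}\,\bigl(a_{\lfloor n/(cn^\beta)\rfloor}(T_n-\theta_0)-q\bigr)\to N(0,\Sigma_\alpha)\quad\text{in distribution as } n\to\infty,$$ where $\Sigma_\alpha$ is the positive semidefinite $d\times d$ matrix with entries $$\frac{\mathbb P(Y_i>q_i,\;Y_j>q_j)-(1-\alpha_i)(1-\alpha_j)}{f_i(q_i)\,f_j(q_j)}.$$ -/

import Mathlib

open MeasureTheory ProbabilityTheory Filter Topology

noncomputable section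

namespace QoE

/-- The `r`-th smallest entry (`1 ≤ r ≤ k`, counted with multiplicity) of a vector `x ∈ ℝ^k`;
the value is `0` for `r` out of range. -/
def orderStat {k : ℕ} (x : Fin k → ℝ) (r : ℕ) : ℝ :=
  if h : 1 ≤ r ∧ r ≤ k then x (Tuple.sort x ⟨r - 1, by omega⟩) else 0

/-- The univariate `α`-quantile of `x ∈ ℝ^k`: the average of the order statistics of ranks
`⌈kα⌉` and `⌊kα + 1⌋`. -/
def sampleQuantile {k : ℕ} (α : ℝ) (x : Fin k → ℝ) : ℝ :=
  (1 / 2) * (orderStat x ⌈(k : ℝ) * α⌉₊ + orderStat x ⌊(k : ℝ) * α + 1⌋₊)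

/-- The component-wise quantile of `k` points of `ℝ^d`, with parameters `α₁, …, α_d`. -/
def compQuantile {d k : ℕ} (α : Fin d → ℝ) (z : Fin k → EuclideanSpace ℝ (Fin d)) :
    EuclideanSpace ℝ (Fin d) :=
  WithLp.toLp 2 fun i => sampleQuantile (α i) fun j => z j i

/-- The number of blocks, `⌊c n^β⌋`. -/
def numBlocks (c β : ℝ) (n : ℕ) : ℕ := ⌊c * (n : ℝ) ^ β⌋₊

/-- The number of observations in each block, `⌊n / (c n^β)⌋`. -/
def blockSize (c β : ℝ) (n : ℕ) : ℕ := ⌊(n : ℝ) / (c * (n : ℝ) ^ β)⌋₊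

/-- The `j`-th block (`j = 0, 1, …`) of `m` consecutive entries of a sequence. -/
def block {E : Type*} (m j : ℕ) (x : ℕ → E) : Fin m → E := fun i => x (j * m + i)

/-- The generalized inverse `F⁻¹(α) = inf {x | α ≤ F x}`. -/
def quantileFn (F : ℝ → ℝ) (α : ℝ) : ℝ := sInf {x | α ≤ F x}

/-- The distribution function of the `i`-th coordinate of the random vector `Y`. -/
def margCdf {Ω : Type*} [MeasurableSpace Ω] {d : ℕ} (P : Measure Ω)
    (Y : Ω → EuclideanSpace ℝ (Fin d)) (i : Fin d) : ℝ → ℝ :=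
  fun x => cdf (P.map fun ω => Y ω i) x

/-- `F_i⁻¹(α_i)`, where `F_i` is the distribution function of the coordinate `Y_i`. -/
def margQuantile {Ω : Type*} [MeasurableSpace Ω] {d : ℕ} (P : Measure Ω)
    (Y : Ω → EuclideanSpace ℝ (Fin d)) (α : Fin d → ℝ) (i : Fin d) : ℝ :=
  quantileFn (margCdf P Y i) (α i)

/-- `f` is a density, with respect to Lebesgue measure, of the real random variable `U`. -/
def IsDensity {Ω : Type*} [MeasurableSpace Ω] (P : Measure Ω) (U : Ω → ℝ) (f : ℝ → ℝ) : Prop :=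
  Measurable f ∧ (∀ x, 0 ≤ f x) ∧
    P.map U = (volume : Measure ℝ).withDensity fun x => ENNReal.ofReal (f x)

/-- The matrix `Σ_α`, with entries
`(ℙ(Y_i > q_i, Y_j > q_j) - (1 - α_i)(1 - α_j)) / (f_i(q_i) f_j(q_j))`, `q_i = F_i⁻¹(α_i)`. -/
def asympCov {Ω : Type*} [MeasurableSpace Ω] {d : ℕ} (P : Measure Ω)
    (Y : Ω → EuclideanSpace ℝ (Fin d)) (f : Fin d → ℝ → ℝ) (α : Fin d → ℝ) :
    Matrix (Fin d) (Fin d) ℝ :=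
  Matrix.of fun i j =>
    (P.real {ω | margQuantile P Y α i < Y ω i ∧ margQuantile P Y α j < Y ω j}
        - (1 - α i) * (1 - α j)) /
      (f i (margQuantile P Y α i) * f j (margQuantile P Y α j))

/-- The rescaled uncontaminated estimator `a_m (Z_m - θ₀)`, computed from the first `m`
observations. -/
def rescaled {Ω E : Type*} {d : ℕ} (X : ℕ → Ω → E)
    (Z : (m : ℕ) → (Fin m → E) → EuclideanSpace ℝ (Fin d))
    (θ₀ : EuclideanSpace ℝ (Fin d)) (a : ℕ → ℝ) (m : ℕ) (ω : Ω) : EuclideanSpace ℝ (Fin d) :=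
  a m • (Z m (block m 0 fun i => X i ω) - θ₀)

/-- The local rate condition at the exponent `b`: with `F_n` the distribution function for blocks
formed with exponent `b`, for every real `y`, `√(n^b) (F(x_n) - F_n(x_n)) → 0` at the points
`x_n = q + y / √⌊n^b⌋`. -/
def LocalRate (F : ℝ → ℝ) (Fn : ℕ → ℝ → ℝ) (q b : ℝ) : Prop :=
  ∀ y : ℝ, Tendsto
    (fun n : ℕ => √((n : ℝ) ^ b) *
      (F (q + y / √(⌊(n : ℝ) ^ b⌋₊ : ℝ)) - Fn n (q + y / √(⌊(n : ℝ) ^ b⌋₊ : ℝ))))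
    atTop (𝓝 0)

/-- The threshold `β_i^*`: the supremum of the `β ∈ (0, 1)` such that the local rate condition
for the `i`-th coordinate holds at all exponents `0 < b ≤ β`. Here `F_{n,i}` is the distribution
function of the `i`-th coordinate of `a_m (Z_m - θ₀)`, `m = ⌊n / (c n^b)⌋`. (It is `0` if there
is no such `β`.) -/
def betaStar {Ω Ω' E : Type*} [MeasurableSpace Ω] [MeasurableSpace Ω'] {d : ℕ}
    (P : Measure Ω) (P' : Measure Ω') (X : ℕ → Ω → E)
    (Z : (m : ℕ) → (Fin m → E) → EuclideanSpace ℝ (Fin d))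
    (θ₀ : EuclideanSpace ℝ (Fin d)) (a : ℕ → ℝ) (Y : Ω' → EuclideanSpace ℝ (Fin d))
    (α : Fin d → ℝ) (c : ℝ) (i : Fin d) : ℝ :=
  sSup {β : ℝ | β ∈ Set.Ioo (0 : ℝ) 1 ∧ ∀ b ∈ Set.Ioc (0 : ℝ) β,
    LocalRate (margCdf P' Y i)
      (fun n => margCdf P (rescaled X Z θ₀ a (blockSize c b n)) i) (margQuantile P' Y α i) b}

/-- For every sample size `n`, at most `l n` of the first `n` observations are contaminated:
`Xt n 0, …, Xt n (n - 1)` is the contaminated sample. The contaminating random variables are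
arbitrary, and the contaminated positions may depend on the data. -/
def IsContamination {Ω E : Type*} [MeasurableSpace Ω] (P : Measure Ω) (X : ℕ → Ω → E)
    (l : ℕ → ℕ) (Xt : ℕ → ℕ → Ω → E) : Prop :=
  ∀ n, ∀ᵐ ω ∂P, {i : ℕ | i < n ∧ Xt n i ω ≠ X i ω}.ncard ≤ l n

/-- `Zt j`, `j = 0, …, k - 1`, are block estimates computed from a contaminated sample `Xt`
divided into `k` blocks of size `m`. On a block without contaminated observations, `Zt j` is the
estimator `Z m` of that block; on a contaminated block, where the estimator need not be uniquely
defined, it may take any value (for instance again the value of `Z m` there). -/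
def IsBlockEstimate {Ω E : Type*} [MeasurableSpace Ω] {d : ℕ} (P : Measure Ω) (X : ℕ → Ω → E)
    (Z : (m : ℕ) → (Fin m → E) → EuclideanSpace ℝ (Fin d)) (Xt : ℕ → Ω → E) (k m : ℕ)
    (Zt : Fin k → Ω → EuclideanSpace ℝ (Fin d)) : Prop :=
  ∀ j, AEMeasurable (Zt j) P ∧ ∀ᵐ ω ∂P,
    block m j (fun i => Xt i ω) = block m j (fun i => X i ω) →
      Zt j ω = Z m (block m j fun i => Xt i ω)

end QoE

end

/-! For each `n` the rescaled estimates from the clean blocks are i.i.d. vectors, and their common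
law converges weakly to that of `Y` because the block size tends to infinity. The blocks are
disjoint, so at most `l n` of them contain a contaminated observation. Everything therefore reduces
to quantiles of a row-wise i.i.d. triangular array with at most `l n` corrupted entries per row. The
only facts kept about the estimator are the two counting inequalities of `IsApproxQuantile`: a
quantile lies below `t` exactly when enough entries do, up to `l n` and a rounding error of one.

Consistency is then Chebyshev's inequality for the number of entries below a fixed level, since `l
n` is negligible compared with the number `k n` of blocks.

Asymptotic normality rests on a Bahadur-type linearization in each coordinate
(`tendstoInMeasure_quantile_sub_upperSum`). The event that the quantile is at most `q + y / r n`
concerns the count at that moving level. Its centred version differs from the one at `q` by `o(√k)`,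
because the variance of the difference is governed by the small mass between the two levels. The
drift `√k (α - F_n(q + y / r n))` tends to `-κ f' y`: the local rate replaces `F_n` by `F`, and `F`
has derivative `f'` at `q`. Hence the rescaled quantile and the normalized sum of indicators
asymptotically never lie on different sides of an interval, and Ghosh's lemma
(`tendstoInMeasure_sub_of_separated`) makes their difference vanish in probability. The indicator
sums form a bounded vector array, handled jointly by `tendstoInDistribution_triangular`, with
limiting covariance supplied by the portmanteau theorem. Slutsky's lemma finishes the argument. -/

namespace QoE

/-! ### Order statistics and sample quantiles through counting -/

section OrderStatistics

variable {k : ℕ}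

/-- Counts are invariant under the sorting permutation, so they can be read off the sorted tuple.
Through this equivalence every later statement on quantiles becomes one on counts. -/
lemma orderStat_le_iff (x : Fin k → ℝ) {r : ℕ} (h1 : 1 ≤ r) (hk : r ≤ k) (t : ℝ) :
    orderStat x r ≤ t ↔ r ≤ (Finset.univ.filter fun j => x j ≤ t).card := by
  rw [orderStat, dif_pos ⟨h1, hk⟩]
  have h := Tuple.lt_card_le_iff_apply_le_of_monotone (j := (⟨r - 1, by omega⟩ : Fin k)) (a := t)
    (Tuple.monotone_sort x)
  have hc : (Finset.univ.filter fun j => (x ∘ Tuple.sort x) j ≤ t).card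
      = (Finset.univ.filter fun j => x j ≤ t).card := by
    refine Finset.card_equiv (Tuple.sort x) fun j => ?_
    simp
  rw [hc] at h
  simp only [Function.comp_apply] at h
  rw [← h]
  omega

lemma orderStat_mono (x : Fin k → ℝ) {r s : ℕ} (h1 : 1 ≤ r) (hrs : r ≤ s) (hk : s ≤ k) :
    orderStat x r ≤ orderStat x s := by
  rw [orderStat_le_iff x h1 (hrs.trans hk)]
  exact hrs.trans ((orderStat_le_iff x (h1.trans hrs) hk _).1 le_rfl)

lemma orderStat_mul_sub (x : Fin k → ℝ) {r : ℕ} (h1 : 1 ≤ r) (hk : r ≤ k) {b : ℝ} (hb : 0 < b)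
    (s : ℝ) : orderStat (fun j => b * (x j - s)) r = b * (orderStat x r - s) := by
  refine eq_of_forall_ge_iff fun t => ?_
  have h (u : ℝ) : b * (u - s) ≤ t ↔ u ≤ t / b + s := by
    rw [← le_div_iff₀' hb, sub_le_iff_le_add]
  rw [orderStat_le_iff _ h1 hk, h, orderStat_le_iff _ h1 hk]
  simp_rw [h]

lemma measurable_orderStat (r : ℕ) : Measurable fun x : Fin k → ℝ => orderStat x r := by
  by_cases h : 1 ≤ r ∧ r ≤ k
  · refine measurable_of_Iic fun t => ?_
    have hs : (fun x : Fin k → ℝ => orderStat x r) ⁻¹' Set.Iic t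
        = {x | (r : ℝ) ≤ ∑ j, (Set.Iic t).indicator 1 (x j)} := by
      ext x
      simp only [Set.mem_preimage, Set.mem_Iic, Set.mem_ofPred_eq, orderStat_le_iff x h.1 h.2]
      simp [Set.indicator_apply]
    rw [hs]
    refine measurableSet_le measurable_const (Finset.measurable_sum _ fun j _ => ?_)
    exact (measurable_one.indicator measurableSet_Iic).comp (measurable_pi_apply j)
  · simp [orderStat, h]

lemma ceil_rank_mem {α : ℝ} (hα : α ∈ Set.Ioo (0 : ℝ) 1) (hk : 1 ≤ k) :
    1 ≤ ⌈(k : ℝ) * α⌉₊ ∧ ⌈(k : ℝ) * α⌉₊ ≤ k := by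
  have hk' : (1 : ℝ) ≤ k := by exact_mod_cast hk
  refine ⟨Nat.one_le_ceil_iff.2 (mul_pos (by linarith) hα.1), Nat.ceil_le.2 ?_⟩
  nlinarith [hα.2]

lemma floor_rank_mem {α : ℝ} (hα : α ∈ Set.Ioo (0 : ℝ) 1) (hk : 1 ≤ k) :
    1 ≤ ⌊(k : ℝ) * α + 1⌋₊ ∧ ⌊(k : ℝ) * α + 1⌋₊ ≤ k := by
  have hk' : (1 : ℝ) ≤ k := by exact_mod_cast hk
  have h0 : 0 ≤ (k : ℝ) * α := mul_nonneg (by linarith) hα.1.le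
  refine ⟨Nat.one_le_floor_iff _ |>.2 (by linarith), ?_⟩
  rw [← Nat.lt_add_one_iff, Nat.floor_lt (by linarith)]
  push_cast
  nlinarith [hα.2]

lemma ceil_rank_le_floor_rank {α : ℝ} (hα : 0 ≤ α) :
    ⌈(k : ℝ) * α⌉₊ ≤ ⌊(k : ℝ) * α + 1⌋₊ := by
  rw [Nat.floor_add_one (by positivity)]
  exact Nat.ceil_le_floor_add_one _

lemma sampleQuantile_mul_sub (x : Fin k → ℝ) {α : ℝ} (hα : α ∈ Set.Ioo (0 : ℝ) 1) (hk : 1 ≤ k)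
    {b : ℝ} (hb : 0 < b) (s : ℝ) :
    sampleQuantile α (fun j => b * (x j - s)) = b * (sampleQuantile α x - s) := by
  obtain ⟨h1, h2⟩ := ceil_rank_mem hα hk
  obtain ⟨h3, h4⟩ := floor_rank_mem hα hk
  rw [sampleQuantile, sampleQuantile, orderStat_mul_sub x h1 h2 hb, orderStat_mul_sub x h3 h4 hb]
  ring

lemma measurable_sampleQuantile (α : ℝ) :
    Measurable fun x : Fin k → ℝ => sampleQuantile α x :=
  ((measurable_orderStat _).add (measurable_orderStat _)).const_mul _

/-- The smaller of the two averaged order statistics is at most their mean, so only the rank `⌈kα⌉`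
matters here. -/
lemma mul_le_card_of_sampleQuantile_le {x : Fin k → ℝ} {α : ℝ} (hα : α ∈ Set.Ioo (0 : ℝ) 1)
    (hk : 1 ≤ k) {t : ℝ} (h : sampleQuantile α x ≤ t) :
    (k : ℝ) * α ≤ (Finset.univ.filter fun j => x j ≤ t).card := by
  obtain ⟨h1, h2⟩ := ceil_rank_mem hα hk
  have hm := orderStat_mono x h1 (ceil_rank_le_floor_rank hα.1.le) (floor_rank_mem hα hk).2
  have : orderStat x ⌈(k : ℝ) * α⌉₊ ≤ t := by
    rw [sampleQuantile] at h
    linarith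
  exact Nat.ceil_le.1 ((orderStat_le_iff x h1 h2 t).1 this)

/-- Here the larger order statistic controls the mean. The extra `1` pays for its rank `⌊kα + 1⌋`;
it is harmless at the scale `√k`. -/
lemma sampleQuantile_le_of_le_card {x : Fin k → ℝ} {α : ℝ} (hα : α ∈ Set.Ioo (0 : ℝ) 1)
    (hk : 1 ≤ k) {t : ℝ}
    (h : (k : ℝ) * α + 1 ≤ (Finset.univ.filter fun j => x j ≤ t).card) :
    sampleQuantile α x ≤ t := by
  obtain ⟨h3, h4⟩ := floor_rank_mem hα hk
  have hm := orderStat_mono x (ceil_rank_mem hα hk).1 (ceil_rank_le_floor_rank hα.1.le) h4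
  have : orderStat x ⌊(k : ℝ) * α + 1⌋₊ ≤ t :=
    (orderStat_le_iff x h3 h4 t).2 (Nat.floor_le_of_le h)
  rw [sampleQuantile]
  linarith

lemma card_le_card_add_of_ncard_ne_le {x y : Fin k → ℝ} {l : ℕ}
    (h : {j | x j ≠ y j}.ncard ≤ l) (t : ℝ) :
    (Finset.univ.filter fun j => x j ≤ t).card
      ≤ (Finset.univ.filter fun j => y j ≤ t).card + l := by
  classical
  have hs : (Finset.univ.filter fun j => x j ≤ t)
      ⊆ (Finset.univ.filter fun j => y j ≤ t) ∪ (Finset.univ.filter fun j => x j ≠ y j) := by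
    intro j
    simp only [Finset.mem_filter, Finset.mem_univ, true_and, Finset.mem_union]
    intro hj
    by_cases hxy : x j = y j
    · exact Or.inl (hxy ▸ hj)
    · exact Or.inr hxy
  refine (Finset.card_le_card hs).trans ((Finset.card_union_le _ _).trans ?_)
  refine Nat.add_le_add_left ?_ _
  rw [Set.ncard_eq_toFinset_card'] at h
  simpa using h

end OrderStatistics

/-! ### Independence and common law of disjoint blocks -/

section Blocks

variable {Ω E : Type*} [MeasurableSpace Ω] [MeasurableSpace E] {P : Measure Ω}
  {X : ℕ → Ω → E}

lemma block_index_injective (k m : ℕ) :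
    Function.Injective fun p : Fin k × Fin m => (p.1 : ℕ) * m + p.2 := by
  rintro ⟨i, a⟩ ⟨j, b⟩ h
  have hm : 0 < m := a.pos
  have h1 : (i : ℕ) = j := by
    have := congrArg (· / m) h
    simpa [Nat.mul_add_div, mul_comm, Nat.div_eq_of_lt, hm] using this
  have h2 : (a : ℕ) = b := by
    have := congrArg (· % m) h
    simpa [Nat.mod_eq_of_lt] using this
  exact Prod.ext (Fin.ext h1) (Fin.ext h2)

lemma measurable_block (hX : ∀ i, Measurable (X i)) (m j : ℕ) :
    Measurable fun ω => block m j fun i => X i ω :=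
  measurable_pi_lambda _ fun _ => hX _

/-- The entries, indexed by pairs (block, position), have a product law; currying turns it into the
product of the block laws. -/
lemma iIndepFun_block (hX : ∀ i, Measurable (X i)) (hind : iIndepFun X P) (k m : ℕ) :
    iIndepFun (fun (j : Fin k) ω => block m j fun i => X i ω) P := by
  have := hind.isProbabilityMeasure
  have hp (p : Fin k × Fin m) : Measurable (X ((p.1 : ℕ) * m + p.2)) := hX _
  have h := (iIndepFun.precomp (block_index_injective k m) hind).map_fun_eq_infinitePi_map hp
  rw [iIndepFun_iff_map_fun_eq_infinitePi_map fun j : Fin k => measurable_block hX m j]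
  have hb (j : Fin k) : P.map (fun ω => block m j fun i => X i ω)
      = Measure.infinitePi fun i : Fin m => P.map (X ((j : ℕ) * m + i)) := by
    refine iIndepFun.map_fun_eq_infinitePi_map (fun i => hX _) ?_
    refine iIndepFun.precomp (g := fun i : Fin m => (j : ℕ) * m + i) (fun a b hab => ?_) hind
    simpa [Fin.ext_iff] using hab
  simp_rw [hb]
  have (i : Fin k) (j : Fin m) : IsProbabilityMeasure (P.map (X ((i : ℕ) * m + j))) :=
    Measure.isProbabilityMeasure_map (hX _).aemeasurable
  rw [← Measure.infinitePi_map_curry (fun (i : Fin k) (j : Fin m) => P.map (X ((i : ℕ) * m + j))),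
    ← h, Measure.map_map (MeasurableEquiv.measurable _) (measurable_pi_lambda _ fun p => hp p)]
  rfl

lemma map_block_eq (hX : ∀ i, Measurable (X i)) (hind : iIndepFun X P)
    (hid : ∀ i, IdentDistrib (X i) (X 0) P P) (m j : ℕ) :
    P.map (fun ω => block m j fun i => X i ω) = P.map (fun ω => block m 0 fun i => X i ω) := by
  have hb (j : ℕ) : P.map (fun ω => block m j fun i => X i ω)
      = Measure.infinitePi fun _ : Fin m => P.map (X 0) := by
    have h : P.map (fun ω => block m j fun i => X i ω)
      = Measure.infinitePi fun i : Fin m => P.map (X (j * m + i)) := by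
      refine iIndepFun.map_fun_eq_infinitePi_map (fun i => hX _) ?_
      refine iIndepFun.precomp (g := fun i : Fin m => j * m + i) (fun a b hab => ?_) hind
      simpa [Fin.ext_iff] using hab
    rw [h]
    simp_rw [(hid _).map_eq]
  rw [hb, hb]

end Blocks

/-! ### Convergence in probability: Ghosh's lemma and reduction to coordinates -/

section Ghosh

variable {Ω ι : Type*} [MeasurableSpace Ω] {P : Measure Ω} [IsProbabilityMeasure P]

/-- Ghosh's lemma: two sequences of random variables, the second one bounded in probability, have
a difference tending to `0` in probability as soon as they asymptotically never lie on different
sides of a nondegenerate interval. -/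
lemma tendstoInMeasure_sub_of_separated {L : Filter ι} {V W : ι → Ω → ℝ}
    (hW : ∀ δ > 0, ∃ M, ∀ᶠ n in L, P.real {ω | M ≤ |W n ω|} ≤ δ)
    (h1 : ∀ y, ∀ ε > 0, Tendsto (fun n => P.real {ω | V n ω ≤ y ∧ y + ε ≤ W n ω}) L (𝓝 0))
    (h2 : ∀ y, ∀ ε > 0, Tendsto (fun n => P.real {ω | y < V n ω ∧ W n ω ≤ y - ε}) L (𝓝 0)) :
    TendstoInMeasure P (fun n ω => V n ω - W n ω) L 0 := by
  rw [tendstoInMeasure_iff_measureReal_norm]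
  intro η hη
  set ε := η / 3 with hε
  have hε0 : 0 < ε := by positivity
  rw [tendsto_order]
  refine ⟨fun a ha => Eventually.of_forall fun n => ha.trans_le measureReal_nonneg, fun a ha => ?_⟩
  obtain ⟨M, hM⟩ := hW (a / 2) (by linarith)
  -- On `|W| < M` only finitely many points of the grid `ε ℤ` are needed. The margin covers the
  -- shifts by `+2` and `-1` below.
  set K : ℤ := ⌈M / ε⌉ + 3
  set G : Finset ℤ := Finset.Icc (-K) K
  have hsum : Tendsto (fun n => ∑ z ∈ G, (P.real {ω | V n ω ≤ z * ε ∧ z * ε + ε ≤ W n ω}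
      + P.real {ω | z * ε < V n ω ∧ W n ω ≤ z * ε - ε})) L (𝓝 0) := by
    have := tendsto_finsetSum G fun z _ => (h1 (z * ε) ε hε0).add (h2 (z * ε) ε hε0)
    simpa using this
  filter_upwards [hM, hsum.eventually (gt_mem_nhds (show 0 < a / 2 by linarith))] with n hn1 hn2
  have hsub : {ω | η ≤ ‖V n ω - W n ω - (0 : Ω → ℝ) ω‖} ⊆ {ω | M ≤ |W n ω|} ∪
      ⋃ z ∈ G, ({ω | V n ω ≤ z * ε ∧ z * ε + ε ≤ W n ω}
        ∪ {ω | z * ε < V n ω ∧ W n ω ≤ z * ε - ε}) := by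
    intro ω hω
    by_cases hMω : M ≤ |W n ω|
    · exact Or.inl hMω
    refine Or.inr ?_
    push Not at hMω
    have hfl := Int.floor_le (W n ω / ε)
    have hfl' := Int.lt_floor_add_one (W n ω / ε)
    rw [le_div_iff₀ hε0] at hfl
    rw [div_lt_iff₀ hε0] at hfl'
    have hMc : M ≤ (⌈M / ε⌉ : ℝ) * ε := (div_le_iff₀ hε0).1 (Int.le_ceil _)
    obtain ⟨hW1, hW2⟩ := abs_lt.1 hMω
    have hb1 : (-⌈M / ε⌉ - 1 : ℤ) < ⌊W n ω / ε⌋ := by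
      have : ((-⌈M / ε⌉ - 1 : ℤ) : ℝ) < ⌊W n ω / ε⌋ := by
        push_cast
        by_contra! hc
        nlinarith
      exact_mod_cast this
    have hb2 : ⌊W n ω / ε⌋ < ⌈M / ε⌉ + 1 := by
      have : ((⌊W n ω / ε⌋ : ℤ) : ℝ) < ⌈M / ε⌉ + 1 := by
        by_contra! hc
        nlinarith
      exact_mod_cast this
    have hω' : η ≤ |V n ω - W n ω| := by simpa using hω
    have h3 : η = 3 * ε := by rw [hε]; ring
    rcases le_abs.1 hω' with h | h
    -- A gap of `3ε` contains a grid point below `V` and at distance at least `ε` above `W`; the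
    -- other case is its mirror image.
    · refine Set.mem_biUnion (x := ⌊W n ω / ε⌋ + 2) ?_ (Or.inr ⟨?_, ?_⟩)
      · simp only [G, K, Finset.coe_Icc, Set.mem_Icc]
        omega
      · push_cast
        nlinarith
      · push_cast
        nlinarith
    · refine Set.mem_biUnion (x := ⌊W n ω / ε⌋ - 1) ?_ (Or.inl ⟨?_, ?_⟩)
      · simp only [G, K, Finset.coe_Icc, Set.mem_Icc]
        omega
      · push_cast
        nlinarith
      · push_cast
        nlinarith
  calc P.real {ω | η ≤ ‖V n ω - W n ω - (0 : Ω → ℝ) ω‖}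
      ≤ _ := measureReal_mono hsub
    _ ≤ P.real {ω | M ≤ |W n ω|} + P.real (⋃ z ∈ G, _) := measureReal_union_le _ _
    _ ≤ a / 2 + ∑ z ∈ G, (P.real {ω | V n ω ≤ z * ε ∧ z * ε + ε ≤ W n ω}
      + P.real {ω | z * ε < V n ω ∧ W n ω ≤ z * ε - ε}) := by
        refine add_le_add hn1 ((measureReal_biUnion_finset_le _ _).trans ?_)
        exact Finset.sum_le_sum fun z _ => measureReal_union_le _ _
    _ < a := by linarith

lemma tendstoInMeasure_euclidean {d : ℕ} {L : Filter ι} {U : ι → Ω → EuclideanSpace ℝ (Fin d)}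
    {u : EuclideanSpace ℝ (Fin d)}
    (h : ∀ i, TendstoInMeasure P (fun n ω => U n ω i) L fun _ => u i) :
    TendstoInMeasure P U L fun _ => u := by
  rw [tendstoInMeasure_iff_measureReal_norm]
  intro ε hε
  have hd : (0 : ℝ) < d + 1 := by positivity
  -- Dividing by `d + 1` instead of `d` keeps the final contradiction strict and includes `d = 0`.
  have hsum : Tendsto (fun n => ∑ i, P.real {ω | ε / (d + 1) ≤ ‖U n ω i - u i‖}) L (𝓝 0) := by
    have := tendsto_finsetSum Finset.univ fun i _ =>
      tendstoInMeasure_iff_measureReal_norm.1 (h i) (ε / (d + 1)) (by positivity)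
    simpa using this
  refine squeeze_zero (fun _ => measureReal_nonneg) (fun n => ?_) hsum
  refine (measureReal_mono (s₂ := ⋃ i, {ω | ε / (d + 1) ≤ ‖U n ω i - u i‖}) ?_).trans
    (measureReal_iUnion_fintype_le _)
  intro ω hω
  by_contra hc
  simp only [Set.mem_iUnion, Set.mem_ofPred_eq, not_exists, not_le] at hc hω
  have h1 : ‖U n ω - u‖ ≤ ∑ i, ‖U n ω i - u i‖ := by
    rw [EuclideanSpace.norm_eq]
    refine Real.sqrt_le_iff.2 ⟨Finset.sum_nonneg fun _ _ => norm_nonneg _, ?_⟩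
    exact Finset.sum_sq_le_sq_sum_of_nonneg fun _ _ => norm_nonneg _
  have h2 : ∑ i, ‖U n ω i - u i‖ ≤ ∑ _i : Fin d, ε / (d + 1) :=
    Finset.sum_le_sum fun i _ => (hc i).le
  rw [Finset.sum_const, Finset.card_univ, Fintype.card_fin, nsmul_eq_mul, mul_div_assoc',
    le_div_iff₀ hd] at h2
  nlinarith

end Ghosh

/-! ### Chebyshev's inequality for i.i.d. bounded sums -/

section Sums

variable {Ω V : Type*} [MeasurableSpace Ω] [MeasurableSpace V] {P : Measure Ω}
  {ν : Measure V}

/-- The bound keeps the second moment of `h` rather than `C ^ 2`: for differences of indicators at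
merging levels this moment tends to zero. -/
lemma measure_le_abs_sum_sub_le {k : ℕ} {W : Fin k → Ω → V} (hW : ∀ j, Measurable (W j))
    (hind : iIndepFun W P) (hlaw : ∀ j, P.map (W j) = ν) {h : V → ℝ} (hh : Measurable h) {C : ℝ}
    (hC : ∀ v, |h v| ≤ C) {s : ℝ} (hs : 0 < s) :
    P.real {ω | s ≤ |∑ j, (h (W j ω) - ∫ v, h v ∂ν)|} ≤ k * (∫ v, h v ^ 2 ∂ν) / s ^ 2 := by
  have := hind.isProbabilityMeasure
  have hL (j : Fin k) : MemLp (fun ω => h (W j ω)) 2 P :=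
    MemLp.of_bound (hh.comp (hW j)).aestronglyMeasurable C (ae_of_all _ fun ω => hC _)
  have hint (j : Fin k) : ∫ ω, h (W j ω) ∂P = ∫ v, h v ∂ν := by
    rw [← hlaw j, integral_map (hW j).aemeasurable hh.aestronglyMeasurable]
  have hint2 (j : Fin k) : ∫ ω, h (W j ω) ^ 2 ∂P = ∫ v, h v ^ 2 ∂ν := by
    rw [← hlaw j, integral_map (hW j).aemeasurable (hh.pow_const 2).aestronglyMeasurable]
  have hvar : variance (∑ j, fun ω => h (W j ω)) P ≤ k * ∫ v, h v ^ 2 ∂ν := by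
    rw [IndepFun.variance_sum (fun j _ => hL j)
      fun i _ j _ hij => (hind.indepFun hij).comp hh hh]
    calc ∑ j, variance (fun ω => h (W j ω)) P ≤ ∑ _j : Fin k, ∫ v, h v ^ 2 ∂ν :=
          Finset.sum_le_sum fun j _ =>
            (variance_le_expectation_sq (hL j).aestronglyMeasurable).trans_eq (hint2 j)
      _ = _ := by simp
  have hLs : MemLp (∑ j, fun ω => h (W j ω)) 2 P := memLp_finsetSum' _ fun j _ => hL j
  have hcheb := meas_ge_le_variance_div_sq hLs hs
  have hmean : ∫ ω, (∑ j, fun ω => h (W j ω)) ω ∂P = ∑ _j : Fin k, ∫ v, h v ∂ν := by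
    simp only [Finset.sum_apply]
    rw [integral_finsetSum _ fun j _ => (hL j).integrable (by norm_num)]
    simp_rw [hint]
  rw [hmean] at hcheb
  have hset : {ω | s ≤ |∑ j, (h (W j ω) - ∫ v, h v ∂ν)|}
      = {ω | s ≤ |(∑ j, fun ω => h (W j ω)) ω - ∑ _j : Fin k, ∫ v, h v ∂ν|} := by
    simp only [Finset.sum_apply, Finset.sum_sub_distrib]
  rw [hset, measureReal_def]
  calc _ ≤ (ENNReal.ofReal (variance (∑ j, fun ω => h (W j ω)) P / s ^ 2)).toReal :=
        ENNReal.toReal_mono ENNReal.ofReal_ne_top hcheb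
    _ = variance (∑ j, fun ω => h (W j ω)) P / s ^ 2 :=
        ENNReal.toReal_ofReal (div_nonneg (variance_nonneg _ _) (sq_nonneg _))
    _ ≤ _ := by gcongr

end Sums

/-! ### Central limit theorem for bounded triangular arrays -/

section CLT

/-- Convergence of `k u` forces `u → 0`; since `log (1 + u) = u + O(u ^ 2)` and `k u ^ 2 → 0`, the
logarithm of the power has the same limit as `k u`. -/
lemma tendsto_one_add_pow_exp_of_tendsto_mul {ι : Type*} {L : Filter ι} {k : ι → ℕ}
    (hk : Tendsto k L atTop) {u : ι → ℂ} {z : ℂ}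
    (hu : Tendsto (fun n => (k n : ℂ) * u n) L (𝓝 z)) :
    Tendsto (fun n => (1 + u n) ^ k n) L (𝓝 (Complex.exp z)) := by
  have hkinv : Tendsto (fun n => ((k n : ℂ))⁻¹) L (𝓝 0) :=
    (tendsto_inv_atTop_nhds_zero_nat (𝕜 := ℂ)).comp hk
  have hk0 : ∀ᶠ n in L, (k n : ℂ) ≠ 0 := by
    filter_upwards [hk.eventually_ge_atTop 1] with n hn
    exact_mod_cast (by omega : k n ≠ 0)
  have hu0 : Tendsto u L (𝓝 0) := by
    have := hkinv.mul hu
    rw [zero_mul] at this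
    refine this.congr' ?_
    filter_upwards [hk0] with n hn
    field_simp
  have hlog : Tendsto (fun n => (k n : ℂ) * Complex.log (1 + u n)) L (𝓝 z) := by
    have hO : (fun n => (k n : ℂ) * (Complex.log (1 + u n) - u n)) =O[L]
        fun n => (k n : ℂ) * u n ^ 2 :=
      (Asymptotics.isBigO_refl _ _).mul (Complex.log_sub_self_isBigO.comp_tendsto hu0)
    have h0 : Tendsto (fun n => (k n : ℂ) * u n ^ 2) L (𝓝 0) := by
      have := (hu.mul hu0)
      rw [mul_zero] at this
      refine this.congr fun n => ?_
      ring
    have := (hO.trans_tendsto h0).add hu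
    rw [zero_add] at this
    refine this.congr fun n => ?_
    ring
  refine ((Complex.continuous_exp.tendsto z).comp hlog).congr' ?_
  filter_upwards [hu0.eventually_ne (show (0 : ℂ) ≠ -1 by simp)] with n hn
  have h1 : 1 + u n ≠ 0 := fun h => hn (by linear_combination h)
  simp only [Function.comp_apply]
  rw [Complex.exp_nat_mul, Complex.exp_log h1]

open scoped RealInnerProductSpace

/-- Second-order Taylor expansion of `exp (i⟪x, t⟫)` under the integral, the linear term vanishing
by centring. The constant `3` bounds the factor `exp ‖⟪x, t⟫‖ ≤ e` in the remainder. The uniform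
cubic error removes the need for a Lindeberg condition. -/
lemma norm_charFun_sub_le {V : Type*} [NormedAddCommGroup V] [InnerProductSpace ℝ V]
    [MeasurableSpace V] [BorelSpace V] [SecondCountableTopology V] {ν : Measure V}
    [IsProbabilityMeasure ν] {C : ℝ}
    (hC : ∀ᵐ x ∂ν, ‖x‖ ≤ C) (hmean : ∀ t : V, ∫ x, ⟪x, t⟫ ∂ν = 0) (t : V) (ht : C * ‖t‖ ≤ 1) :
    ‖charFun ν t - (1 - ((∫ x, ⟪x, t⟫ ^ 2 ∂ν : ℝ) : ℂ) / 2)‖ ≤ 3 * (C * ‖t‖) ^ 3 := by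
  have hb : ∀ᵐ x ∂ν, ‖⟪x, t⟫‖ ≤ C * ‖t‖ := by
    filter_upwards [hC] with x hx
    exact (norm_inner_le_norm x t).trans (by gcongr)
  have hm : AEStronglyMeasurable (fun x : V => ⟪x, t⟫) ν :=
    (measurable_id.inner_const (𝕜 := ℝ) (c := t)).aestronglyMeasurable
  have hi1 : Integrable (fun x : V => ⟪x, t⟫) ν := .of_bound hm _ hb
  have hi2 : Integrable (fun x : V => ⟪x, t⟫ ^ 2) ν := by
    refine .of_bound (hm.pow 2) ((C * ‖t‖) ^ 2) ?_
    filter_upwards [hb] with x hx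
    rw [norm_pow]
    gcongr
  have hie : Integrable (fun x : V => Complex.exp (⟪x, t⟫ * Complex.I)) ν := by
    refine .of_bound (Measurable.aestronglyMeasurable (by fun_prop)) 1 (ae_of_all _ fun x => ?_)
    rw [Complex.norm_exp_ofReal_mul_I]
  have heq : charFun ν t - (1 - ((∫ x, ⟪x, t⟫ ^ 2 ∂ν : ℝ) : ℂ) / 2)
      = ∫ x, (Complex.exp (⟪x, t⟫ * Complex.I)
          - (1 + (⟪x, t⟫ : ℂ) * Complex.I - ((⟪x, t⟫ ^ 2 : ℝ) : ℂ) / 2)) ∂ν := by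
    rw [integral_sub hie, integral_sub, integral_add (integrable_const _), integral_mul_const,
      integral_div, charFun_apply]
    · have h0 : ∫ x, ((⟪x, t⟫ : ℝ) : ℂ) ∂ν = 0 := by
        rw [integral_complex_ofReal, hmean t, Complex.ofReal_zero]
      rw [h0, integral_complex_ofReal]
      simp
    · exact hi1.ofReal.mul_const _
    · exact (integrable_const _).add (hi1.ofReal.mul_const _)
    · exact hi2.ofReal.div_const _
    · exact ((integrable_const _).add (hi1.ofReal.mul_const _)).sub (hi2.ofReal.div_const _)
  rw [heq]
  refine (norm_integral_le_of_norm_le_const (C := 3 * (C * ‖t‖) ^ 3) ?_).trans (by simp)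
  filter_upwards [hb] with x hx
  have hx1 : ‖(⟪x, t⟫ : ℂ) * Complex.I‖ = ‖⟪x, t⟫‖ := by simp
  have := Complex.norm_exp_sub_sum_le_norm_mul_exp ((⟪x, t⟫ : ℂ) * Complex.I) 3
  rw [hx1] at this
  have hexp : Real.exp ‖⟪x, t⟫‖ ≤ 3 :=
    (Real.exp_le_exp.2 (hx.trans ht)).trans (by linarith [Real.exp_one_lt_d9])
  have hsum : ∑ m ∈ Finset.range 3, ((⟪x, t⟫ : ℂ) * Complex.I) ^ m / (m.factorial : ℂ)
      = 1 + (⟪x, t⟫ : ℂ) * Complex.I - ((⟪x, t⟫ ^ 2 : ℝ) : ℂ) / 2 := by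
    simp [Finset.sum_range_succ, mul_pow, Nat.factorial]
    ring
  rw [hsum] at this
  calc _ ≤ ‖⟪x, t⟫‖ ^ 3 * Real.exp ‖⟪x, t⟫‖ := this
    _ ≤ (C * ‖t‖) ^ 3 * 3 := by
      have := (norm_nonneg _).trans hx
      gcongr
    _ = _ := by ring

/-- The central limit theorem for uniformly bounded triangular arrays with identically
distributed rows. -/
theorem tendstoInDistribution_triangular {Ω : Type*} [MeasurableSpace Ω] {P : Measure Ω}
    [IsProbabilityMeasure P] {d : ℕ} {k : ℕ → ℕ} (hk : Tendsto k atTop atTop)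
    {B : (n : ℕ) → Fin (k n) → Ω → EuclideanSpace ℝ (Fin d)} (hB : ∀ n j, Measurable (B n j))
    (hind : ∀ n, iIndepFun (B n) P) {ν : ℕ → Measure (EuclideanSpace ℝ (Fin d))}
    [∀ n, IsProbabilityMeasure (ν n)] (hlaw : ∀ n j, P.map (B n j) = ν n) {C : ℝ}
    (hC : ∀ n, ∀ᵐ x ∂ν n, ‖x‖ ≤ C)
    (hmean : ∀ n, ∀ t : EuclideanSpace ℝ (Fin d), ∫ x, ⟪x, t⟫ ∂ν n = 0)
    {S : Matrix (Fin d) (Fin d) ℝ} (hS : S.PosSemidef)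
    (hvar : ∀ t : EuclideanSpace ℝ (Fin d),
      Tendsto (fun n => ∫ x, ⟪x, t⟫ ^ 2 ∂ν n) atTop (𝓝 (t ⬝ᵥ S.mulVec t))) :
    TendstoInDistribution (fun (n : ℕ) ω => (√(k n : ℝ))⁻¹ • ∑ j, B n j ω) atTop id (fun _ => P)
      (multivariateGaussian 0 S) where
  forall_aemeasurable n := by
    have : Measurable fun ω => ∑ j, B n j ω := Finset.measurable_sum _ fun j _ => hB n j
    exact (this.const_smul (√(k n : ℝ))⁻¹).aemeasurable
  tendsto := by
    refine ProbabilityMeasure.tendsto_iff_tendsto_charFun.2 fun t => ?_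
    simp only [ProbabilityMeasure.coe_mk, Measure.map_id]
    rw [charFun_multivariateGaussian hS]
    have hchar (n : ℕ) : charFun (P.map fun ω => (√(k n : ℝ))⁻¹ • ∑ j, B n j ω) t
        = (1 + (charFun (ν n) ((√(k n : ℝ))⁻¹ • t) - 1)) ^ k n := by
      have hm : Measurable fun ω => ∑ j, B n j ω := Finset.measurable_sum _ fun j _ => hB n j
      have h1 : P.map (fun ω => (√(k n : ℝ))⁻¹ • ∑ j, B n j ω)
          = (P.map fun ω => ∑ j, B n j ω).map fun x => (√(k n : ℝ))⁻¹ • x := by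
        rw [Measure.map_map (by fun_prop) hm]
        rfl
      rw [h1, charFun_map_smul,
        (hind n).charFun_map_fun_sum_eq_prod fun j => (hB n j).aemeasurable]
      simp [hlaw]
    simp_rw [hchar]
    refine tendsto_one_add_pow_exp_of_tendsto_mul hk ?_
    have hkinv : Tendsto (fun n => (√(k n : ℝ))⁻¹) atTop (𝓝 0) :=
      tendsto_inv_atTop_zero.comp (Real.tendsto_sqrt_atTop.comp
        (tendsto_natCast_atTop_atTop.comp hk))
    have hsmall : Tendsto (fun n => C * ‖(√(k n : ℝ))⁻¹ • t‖) atTop (𝓝 0) := by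
      have := ((hkinv.smul_const t).norm).const_mul C
      simpa using this
    have hbound : Tendsto (fun n => 3 * (C * ‖t‖) ^ 3 * (√(k n : ℝ))⁻¹) atTop (𝓝 0) := by
      simpa using hkinv.const_mul (3 * (C * ‖t‖) ^ 3)
    have hmain : Tendsto (fun n => -((∫ x, ⟪x, t⟫ ^ 2 ∂ν n : ℝ) : ℂ) / 2) atTop
        (𝓝 (-((t ⬝ᵥ S.mulVec t : ℝ) : ℂ) / 2)) :=
      (((Complex.continuous_ofReal.tendsto _).comp (hvar t)).neg).div_const 2
    -- At argument `t / √k` the cubic error is `O(k ^ (-3/2))`, so multiplying by `k` still leaves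
    -- `O(1 / √k)`.
    have hdiff : Tendsto (fun n => (k n : ℂ) * (charFun (ν n) ((√(k n : ℝ))⁻¹ • t) - 1)
        - -((∫ x, ⟪x, t⟫ ^ 2 ∂ν n : ℝ) : ℂ) / 2) atTop (𝓝 0) := by
      refine squeeze_zero_norm' ?_ hbound
      filter_upwards [hsmall.eventually (ge_mem_nhds one_pos), hk.eventually_ge_atTop 1]
        with n hn hkn
      have hk0 : (0 : ℝ) < k n := by exact_mod_cast hkn
      have hsq : (k n : ℝ) = √(k n : ℝ) ^ 2 := (Real.sq_sqrt hk0.le).symm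
      have hs0 : 0 < √(k n : ℝ) := Real.sqrt_pos.2 hk0
      have h := norm_charFun_sub_le (hC n) (hmean n) ((√(k n : ℝ))⁻¹ • t) hn
      have hi : ∫ x, ⟪x, (√(k n : ℝ))⁻¹ • t⟫ ^ 2 ∂ν n
          = (k n : ℝ)⁻¹ * ∫ x, ⟪x, t⟫ ^ 2 ∂ν n := by
        rw [← integral_const_mul]
        congr 1 with x
        rw [real_inner_smul_right, mul_pow, inv_pow, ← hsq]
      rw [hi] at h
      have heq : (k n : ℂ) * (charFun (ν n) ((√(k n : ℝ))⁻¹ • t) - 1)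
          - -((∫ x, ⟪x, t⟫ ^ 2 ∂ν n : ℝ) : ℂ) / 2
          = (k n : ℂ) * (charFun (ν n) ((√(k n : ℝ))⁻¹ • t)
            - (1 - (((k n : ℝ)⁻¹ * ∫ x, ⟪x, t⟫ ^ 2 ∂ν n : ℝ) : ℂ) / 2)) := by
        have : (k n : ℂ) ≠ 0 := by exact_mod_cast hk0.ne'
        push_cast
        field_simp
        ring
      rw [heq, norm_mul, Complex.norm_natCast]
      calc (k n : ℝ) * _ ≤ k n * (3 * (C * ‖(√(k n : ℝ))⁻¹ • t‖) ^ 3) := by gcongr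
        _ = 3 * (C * ‖t‖) ^ 3 * (√(k n : ℝ))⁻¹ := by
          rw [norm_smul, Real.norm_of_nonneg (inv_nonneg.2 hs0.le)]
          nth_rw 1 [hsq]
          field_simp
    have := hdiff.add hmain
    simp only [sub_add_cancel, zero_add] at this
    convert this using 2
    simp [neg_div]

end CLT

/-! ### Quantiles and derivatives of distribution functions with a density -/

section Density

variable {μ : Measure ℝ} {f : ℝ → ℝ}

lemma bddBelow_le_cdf {α : ℝ} (hα : 0 < α) : BddBelow {x | α ≤ cdf μ x} := by
  obtain ⟨b, hb⟩ := eventually_atBot.1 ((tendsto_cdf_atBot μ).eventually (gt_mem_nhds hα))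
  refine ⟨b, fun x hx => ?_⟩
  by_contra! hc
  exact (hb x hc.le).not_ge hx

lemma cdf_lt_of_lt_quantileFn {α : ℝ} (hα : 0 < α) {x : ℝ} (hx : x < quantileFn (cdf μ) α) :
    cdf μ x < α := by
  by_contra! hc
  exact hx.not_ge (csInf_le (bddBelow_le_cdf hα) hc)

lemma cdf_quantileFn (hcont : Continuous (cdf μ)) {α : ℝ} (hα : α ∈ Set.Ioo (0 : ℝ) 1) :
    cdf μ (quantileFn (cdf μ) α) = α := by
  refine le_antisymm ?_ ?_
  · refine le_of_tendsto (hcont.continuousWithinAt (s := Set.Iio (quantileFn (cdf μ) α))) ?_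
    filter_upwards [self_mem_nhdsWithin] with x hx
    exact (cdf_lt_of_lt_quantileFn hα.1 hx).le
  · obtain ⟨x, hx⟩ := ((tendsto_cdf_atTop μ).eventually (lt_mem_nhds hα.2)).exists
    exact (isClosed_le continuous_const hcont).csInf_mem ⟨x, hx.le⟩ (bddBelow_le_cdf hα.1)

/-- Otherwise monotonicity would make the distribution function constant to the right of `q`, with
right derivative zero. -/
lemma lt_cdf_add {q f' : ℝ} (h : HasDerivAt (cdf μ) f' q) (hf' : 0 < f') {ε : ℝ}
    (hε : 0 < ε) : cdf μ q < cdf μ (q + ε) := by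
  refine lt_of_le_of_ne (monotone_cdf μ (by linarith)) fun heq => hf'.ne' ?_
  have hev : (cdf μ : ℝ → ℝ) =ᶠ[𝓝[>] q] fun _ => cdf μ q := by
    filter_upwards [Ioo_mem_nhdsGT (show q < q + ε by linarith)] with x hx
    exact le_antisymm ((monotone_cdf μ hx.2.le).trans_eq heq.symm) (monotone_cdf μ hx.1.le)
  exact (uniqueDiffWithinAt_Ioi q).eq_deriv _ h.hasDerivWithinAt
    ((hasDerivWithinAt_const q _ (cdf μ q)).congr_of_eventuallyEq hev rfl)

variable [IsProbabilityMeasure μ]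

lemma integrable_of_withDensity (hfm : Measurable f) (hf0 : ∀ x, 0 ≤ f x)
    (hμ : μ = (volume : Measure ℝ).withDensity fun x => ENNReal.ofReal (f x)) :
    Integrable f := by
  refine ⟨hfm.aestronglyMeasurable, ?_⟩
  rw [hasFiniteIntegral_iff_ofReal (ae_of_all _ hf0)]
  have := measure_lt_top μ Set.univ
  rwa [hμ, withDensity_apply _ MeasurableSet.univ, setLIntegral_univ] at this

lemma cdf_sub_cdf (hfm : Measurable f) (hf0 : ∀ x, 0 ≤ f x)
    (hμ : μ = (volume : Measure ℝ).withDensity fun x => ENNReal.ofReal (f x)) (x y : ℝ) :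
    cdf μ x - cdf μ y = ∫ u in y..x, f u := by
  have h (x : ℝ) : cdf μ x = ∫ u in Set.Iic x, f u := by
    rw [cdf_eq_real, measureReal_def, hμ, withDensity_apply _ measurableSet_Iic,
      integral_eq_lintegral_of_nonneg_ae (ae_of_all _ hf0) hfm.aestronglyMeasurable]
  have hint := integrable_of_withDensity hfm hf0 hμ
  rw [h, h, intervalIntegral.integral_Iic_sub_Iic hint.integrableOn hint.integrableOn]

lemma cdf_eq_add_integral (hfm : Measurable f) (hf0 : ∀ x, 0 ≤ f x)
    (hμ : μ = (volume : Measure ℝ).withDensity fun x => ENNReal.ofReal (f x)) (y : ℝ) :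
    (cdf μ : ℝ → ℝ) = fun x => cdf μ y + ∫ u in y..x, f u := by
  ext x
  rw [← cdf_sub_cdf hfm hf0 hμ]
  ring

lemma continuous_cdf (hfm : Measurable f) (hf0 : ∀ x, 0 ≤ f x)
    (hμ : μ = (volume : Measure ℝ).withDensity fun x => ENNReal.ofReal (f x)) :
    Continuous (cdf μ) := by
  rw [cdf_eq_add_integral hfm hf0 hμ 0]
  exact continuous_const.add (intervalIntegral.continuous_primitive
    (fun _ _ => (integrable_of_withDensity hfm hf0 hμ).intervalIntegrable) 0)

lemma hasDerivAt_cdf (hfm : Measurable f) (hf0 : ∀ x, 0 ≤ f x)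
    (hμ : μ = (volume : Measure ℝ).withDensity fun x => ENNReal.ofReal (f x)) {q : ℝ}
    (hq : ContinuousAt f q) : HasDerivAt (cdf μ) (f q) q := by
  rw [cdf_eq_add_integral hfm hf0 hμ q]
  exact (intervalIntegral.integral_hasDerivAt_right
    (integrable_of_withDensity hfm hf0 hμ).intervalIntegrable
    hfm.stronglyMeasurable.stronglyMeasurableAtFilter hq).const_add _

end Density

/-! ### Centred indicator vectors and their covariance -/

section Score

variable {d : ℕ}

open scoped RealInnerProductSpace

/-- The centered indicators of `{q_i < x_i}`, divided by `s_i`. -/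
noncomputable def upperScore (ν : Measure (EuclideanSpace ℝ (Fin d))) (q s : Fin d → ℝ)
    (x : EuclideanSpace ℝ (Fin d)) : EuclideanSpace ℝ (Fin d) :=
  WithLp.toLp 2 fun i => ((Set.Ioi (q i)).indicator 1 (x i) - ν.real {v | q i < v i}) / s i

/-- The covariance matrix of `upperScore`. -/
noncomputable def upperCov (ν : Measure (EuclideanSpace ℝ (Fin d))) (q s : Fin d → ℝ) :
    Matrix (Fin d) (Fin d) ℝ :=
  Matrix.of fun i j => (ν.real {v | q i < v i ∧ q j < v j}
    - ν.real {v | q i < v i} * ν.real {v | q j < v j}) / (s i * s j)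

variable {ν : Measure (EuclideanSpace ℝ (Fin d))} {q s : Fin d → ℝ}

lemma measurable_upperScore : Measurable (upperScore ν q s) := by
  refine (WithLp.measurable_toLp 2 _).comp (measurable_pi_lambda _ fun i => ?_)
  have h : Measurable ((Set.Ioi (q i)).indicator (1 : ℝ → ℝ)) :=
    measurable_one.indicator measurableSet_Ioi
  have hi : Measurable fun x : EuclideanSpace ℝ (Fin d) => x i := by fun_prop
  exact ((h.comp hi).sub_const _).div_const _

lemma measurableSet_lt_coord (i : Fin d) (a : ℝ) :
    MeasurableSet {v : EuclideanSpace ℝ (Fin d) | a < v i} :=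
  measurableSet_lt measurable_const (by fun_prop)

lemma abs_indicator_sub_le {t p : ℝ} (hp0 : 0 ≤ p) (hp1 : p ≤ 1) (S : Set ℝ) :
    |S.indicator 1 t - p| ≤ 1 := by
  by_cases h : t ∈ S
  · simp only [h, Set.indicator_of_mem, Pi.one_apply, abs_le]
    constructor <;> linarith
  · simp only [h, not_false_eq_true, Set.indicator_of_notMem, abs_le]
    constructor <;> linarith

lemma integral_indicator_coord (i : Fin d) (a : ℝ) :
    ∫ x, (Set.Ioi a).indicator (1 : ℝ → ℝ) (x i) ∂ν = ν.real {v | a < v i} := by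
  rw [← integral_indicator_one (measurableSet_lt_coord i a)]
  congr 1

variable [IsProbabilityMeasure ν]

lemma norm_upperScore_le (x : EuclideanSpace ℝ (Fin d)) :
    ‖upperScore ν q s x‖ ≤ √(∑ i, (1 / |s i|) ^ 2) := by
  rw [EuclideanSpace.norm_eq]
  refine Real.sqrt_le_sqrt (Finset.sum_le_sum fun i _ => ?_)
  refine pow_le_pow_left₀ (norm_nonneg _) ?_ 2
  rw [upperScore, Real.norm_eq_abs, abs_div]
  gcongr
  exact abs_indicator_sub_le measureReal_nonneg measureReal_le_one _

lemma integrable_centered (i : Fin d) (a : ℝ) :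
    Integrable (fun x : EuclideanSpace ℝ (Fin d) => (Set.Ioi a).indicator (1 : ℝ → ℝ) (x i)) ν := by
  have h : (fun x : EuclideanSpace ℝ (Fin d) => (Set.Ioi a).indicator (1 : ℝ → ℝ) (x i))
      = {v : EuclideanSpace ℝ (Fin d) | a < v i}.indicator 1 := by
    ext x
    simp [Set.indicator_apply]
  rw [h]
  exact (integrable_const (1 : ℝ)).indicator (measurableSet_lt_coord i a)

lemma integrable_upperScore (i : Fin d) : Integrable (fun x => upperScore ν q s x i) ν :=
  ((integrable_centered i (q i)).sub (integrable_const _)).div_const _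

lemma integral_upperScore (i : Fin d) : ∫ x, upperScore ν q s x i ∂ν = 0 := by
  simp only [upperScore]
  rw [integral_div, integral_sub (integrable_centered i (q i)) (integrable_const _),
    integral_indicator_coord]
  simp

lemma integral_inner_upperScore (t : EuclideanSpace ℝ (Fin d)) :
    ∫ x, ⟪upperScore ν q s x, t⟫ ∂ν = 0 := by
  simp_rw [PiLp.inner_apply]
  rw [integral_finsetSum]
  · refine Finset.sum_eq_zero fun i _ => ?_
    simp only [RCLike.inner_apply, conj_trivial]
    rw [integral_const_mul, integral_upperScore, mul_zero]
  · intro i _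
    simp only [RCLike.inner_apply, conj_trivial]
    exact (integrable_upperScore i).const_mul _

lemma integrable_upperScore_mul (i j : Fin d) :
    Integrable (fun x => upperScore ν q s x i * upperScore ν q s x j) ν := by
  have hm (i : Fin d) : Measurable fun x => upperScore ν q s x i := by
    have : Measurable fun x : EuclideanSpace ℝ (Fin d) => x i := by fun_prop
    exact this.comp measurable_upperScore
  have hb (i : Fin d) (x : EuclideanSpace ℝ (Fin d)) :
      ‖upperScore ν q s x i‖ ≤ √(∑ i, (1 / |s i|) ^ 2) :=
    (PiLp.norm_apply_le _ i).trans (norm_upperScore_le x)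
  refine .of_bound ((hm i).mul (hm j)).aestronglyMeasurable
    (√(∑ i, (1 / |s i|) ^ 2) * √(∑ i, (1 / |s i|) ^ 2)) (ae_of_all _ fun x => ?_)
  rw [norm_mul]
  exact mul_le_mul (hb i x) (hb j x) (norm_nonneg _) (Real.sqrt_nonneg _)

lemma integral_upperScore_mul (i j : Fin d) :
    ∫ x, upperScore ν q s x i * upperScore ν q s x j ∂ν = upperCov ν q s i j := by
  set p := fun i => ν.real {v | q i < v i} with hp
  have hS : MeasurableSet {v : EuclideanSpace ℝ (Fin d) | q i < v i ∧ q j < v j} :=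
    (measurableSet_lt_coord i (q i)).inter (measurableSet_lt_coord j (q j))
  have heq (x : EuclideanSpace ℝ (Fin d)) : upperScore ν q s x i * upperScore ν q s x j
      = ({v : EuclideanSpace ℝ (Fin d) | q i < v i ∧ q j < v j}.indicator 1 x
        - p j * (Set.Ioi (q i)).indicator 1 (x i) - p i * (Set.Ioi (q j)).indicator 1 (x j)
        + p i * p j) / (s i * s j) := by
    have h : {v : EuclideanSpace ℝ (Fin d) | q i < v i ∧ q j < v j}.indicator (1 : EuclideanSpace ℝ (Fin d) → ℝ) x
        = (Set.Ioi (q i)).indicator 1 (x i) * (Set.Ioi (q j)).indicator 1 (x j) := by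
      simp only [Set.indicator_apply, Set.mem_ofPred_eq, Set.mem_Ioi, Pi.one_apply]
      split_ifs <;> simp_all
    rw [h]
    simp only [upperScore, hp]
    rw [div_mul_div_comm]
    congr 1
    ring
  simp_rw [heq]
  have h1 : Integrable ({v : EuclideanSpace ℝ (Fin d) | q i < v i ∧ q j < v j}.indicator
      (1 : EuclideanSpace ℝ (Fin d) → ℝ)) ν := (integrable_const (1 : ℝ)).indicator hS
  have h2 := (integrable_centered (ν := ν) i (q i)).const_mul (p j)
  have h3 := (integrable_centered (ν := ν) j (q j)).const_mul (p i)
  rw [integral_div, integral_add, integral_sub, integral_sub, integral_const_mul,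
    integral_const_mul, integral_indicator_coord, integral_indicator_coord,
    integral_indicator_one hS, upperCov, Matrix.of_apply]
  · congr 1
    simp only [hp, integral_const, probReal_univ, one_smul]
    ring
  · exact h1
  · exact h2
  · exact h1.sub h2
  · exact h3
  · exact (h1.sub h2).sub h3
  · exact integrable_const _

lemma integral_inner_upperScore_sq (t : EuclideanSpace ℝ (Fin d)) :
    ∫ x, ⟪upperScore ν q s x, t⟫ ^ 2 ∂ν = t ⬝ᵥ (upperCov ν q s).mulVec t := by
  have heq (x : EuclideanSpace ℝ (Fin d)) : ⟪upperScore ν q s x, t⟫ ^ 2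
      = ∑ i, ∑ j, t i * t j * (upperScore ν q s x i * upperScore ν q s x j) := by
    rw [PiLp.inner_apply, sq, Finset.sum_mul_sum]
    refine Finset.sum_congr rfl fun i _ => Finset.sum_congr rfl fun j _ => ?_
    simp only [RCLike.inner_apply, conj_trivial]
    ring
  simp_rw [heq]
  rw [integral_finsetSum _ fun i _ => integrable_finsetSum _ fun j _ =>
    (integrable_upperScore_mul i j).const_mul _, dotProduct]
  refine Finset.sum_congr rfl fun i _ => ?_
  rw [integral_finsetSum _ fun j _ => (integrable_upperScore_mul i j).const_mul _, Matrix.mulVec,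
    dotProduct, Finset.mul_sum]
  refine Finset.sum_congr rfl fun j _ => ?_
  rw [integral_const_mul, integral_upperScore_mul]
  ring

/-- The quadratic form is the second moment of `⟪upperScore ν q s x, t⟫`. -/
lemma posSemidef_upperCov : (upperCov ν q s).PosSemidef := by
  refine Matrix.PosSemidef.of_dotProduct_mulVec_nonneg ?_ fun x => ?_
  · ext i j
    simp only [upperCov, Matrix.conjTranspose_apply, Matrix.of_apply, star_trivial]
    rw [mul_comm (s j), mul_comm (ν.real {v | q j < v j})]
    simp_rw [and_comm]
  · have h := integral_inner_upperScore_sq (ν := ν) (q := q) (s := s) (WithLp.toLp 2 x)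
    simp only [star_trivial]
    rw [← h]
    exact integral_nonneg fun _ => sq_nonneg _

end Score

/-! ### Weak convergence on half-spaces and quadrants -/

section Portmanteau

variable {d : ℕ} {ι : Type*} {L : Filter ι}
  {ν : ι → ProbabilityMeasure (EuclideanSpace ℝ (Fin d))}
  {μ : ProbabilityMeasure (EuclideanSpace ℝ (Fin d))}

lemma tendsto_real_of_frontier_null (h : Tendsto ν L (𝓝 μ)) {S : Set (EuclideanSpace ℝ (Fin d))}
    (hS : (μ : Measure (EuclideanSpace ℝ (Fin d))) (frontier S) = 0) :
    Tendsto (fun n => (ν n : Measure (EuclideanSpace ℝ (Fin d))).real S) L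
      (𝓝 ((μ : Measure (EuclideanSpace ℝ (Fin d))).real S)) :=
  (ENNReal.tendsto_toReal (measure_ne_top _ _)).comp
    (ProbabilityMeasure.tendsto_measure_of_null_frontier_of_tendsto' h hS)

lemma tendsto_real_coord_le (h : Tendsto ν L (𝓝 μ)) (i : Fin d) {a : ℝ}
    (ha : (μ : Measure (EuclideanSpace ℝ (Fin d))) {v | v i = a} = 0) :
    Tendsto (fun n => (ν n : Measure (EuclideanSpace ℝ (Fin d))).real {v | v i ≤ a}) L
      (𝓝 ((μ : Measure (EuclideanSpace ℝ (Fin d))).real {v | v i ≤ a})) :=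
  tendsto_real_of_frontier_null h <| measure_mono_null
    (frontier_le_subset_eq (by fun_prop) continuous_const) ha

lemma frontier_lt_coord_null (i : Fin d) {a : ℝ}
    (ha : (μ : Measure (EuclideanSpace ℝ (Fin d))) {v | v i = a} = 0) :
    (μ : Measure (EuclideanSpace ℝ (Fin d))) (frontier {v | a < v i}) = 0 := by
  refine measure_mono_null (frontier_lt_subset_eq continuous_const (by fun_prop)) ?_
  simpa only [eq_comm] using ha

/-- The boundaries of the half-spaces and of their intersections lie in the hyperplanes `v i = q i`,
which are null for the limit law. -/
lemma tendsto_upperCov (h : Tendsto ν L (𝓝 μ)) {q s : Fin d → ℝ}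
    (hq : ∀ i, (μ : Measure (EuclideanSpace ℝ (Fin d))) {v | v i = q i} = 0) :
    Tendsto (fun n => upperCov (ν n : Measure (EuclideanSpace ℝ (Fin d))) q s) L
      (𝓝 (upperCov (μ : Measure (EuclideanSpace ℝ (Fin d))) q s)) := by
  refine tendsto_pi_nhds.2 fun i => tendsto_pi_nhds.2 fun j => ?_
  have h1 (i : Fin d) := tendsto_real_of_frontier_null h (frontier_lt_coord_null i (hq i))
  have h2 := tendsto_real_of_frontier_null h
    (S := {v : EuclideanSpace ℝ (Fin d) | q i < v i ∧ q j < v j}) <| by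
      refine measure_mono_null (frontier_inter_subset {v : EuclideanSpace ℝ (Fin d) | q i < v i}
        {v | q j < v j}) (measure_union_null ?_ ?_)
      · exact measure_mono_null Set.inter_subset_left (frontier_lt_coord_null i (hq i))
      · exact measure_mono_null Set.inter_subset_right (frontier_lt_coord_null j (hq j))
  exact (h2.sub ((h1 i).mul (h1 j))).div_const _

end Portmanteau

/-! ### Approximate quantiles of arrays: consistency and linearization -/

/-- The number of entries of `x` that are at most `t`. -/
noncomputable def countLE {k : ℕ} (x : Fin k → ℝ) (t : ℝ) : ℕ := (Finset.univ.filter fun j => x j ≤ t).card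

lemma countLE_eq_sum {k : ℕ} (x : Fin k → ℝ) (t : ℝ) :
    (countLE x t : ℝ) = ∑ j, (Set.Iic t).indicator 1 (x j) := by
  simp [countLE, Set.indicator_apply]

/-- Eventually, almost surely, `Q n` is an `α`-quantile of `ξ n`, up to `l n` corrupted entries. -/
def IsApproxQuantile {Ω : Type*} [MeasurableSpace Ω] (P : Measure Ω) {k : ℕ → ℕ}
    (ξ : (n : ℕ) → Fin (k n) → Ω → ℝ) (l : ℕ → ℕ) (α : ℝ) (Q : ℕ → Ω → ℝ) : Prop :=
  ∀ᶠ n in atTop, ∀ᵐ ω ∂P, ∀ t,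
    (Q n ω ≤ t → (k n : ℝ) * α ≤ countLE (fun j => ξ n j ω) t + l n) ∧
    ((k n : ℝ) * α + 1 + l n ≤ countLE (fun j => ξ n j ω) t → Q n ω ≤ t)

section

variable {Ω : Type*} [MeasurableSpace Ω] {P : Measure Ω} [IsProbabilityMeasure P] {k : ℕ → ℕ}
  {ξ : (n : ℕ) → Fin (k n) → Ω → ℝ} {ν : ℕ → Measure ℝ} [∀ n, IsProbabilityMeasure (ν n)]
  {l : ℕ → ℕ} {α : ℝ} {Q : ℕ → Ω → ℝ}

lemma measurable_indicator_Iic (t : ℝ) : Measurable ((Set.Iic t).indicator (1 : ℝ → ℝ)) :=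
  measurable_one.indicator measurableSet_Iic

lemma abs_indicator_le_one (S : Set ℝ) (x : ℝ) : |S.indicator (1 : ℝ → ℝ) x| ≤ 1 := by
  simpa using abs_indicator_sub_le le_rfl zero_le_one S (t := x)

omit [IsProbabilityMeasure P] in
lemma measure_countLE_dev_le {k : ℕ} {ξ : Fin k → Ω → ℝ} {ν : Measure ℝ} [IsProbabilityMeasure ν]
    (hξ : ∀ j, Measurable (ξ j)) (hind : iIndepFun ξ P) (hlaw : ∀ j, P.map (ξ j) = ν)
    (t : ℝ) {s : ℝ} (hs : 0 < s) :
    P.real {ω | s ≤ |countLE (fun j => ξ j ω) t - k * cdf ν t|} ≤ k / s ^ 2 := by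
  have h := measure_le_abs_sum_sub_le hξ hind hlaw (measurable_indicator_Iic t)
    (abs_indicator_le_one _) hs
  have h1 : ∫ v, (Set.Iic t).indicator (1 : ℝ → ℝ) v ∂ν = cdf ν t := by
    rw [integral_indicator_one measurableSet_Iic, cdf_eq_real]
  have h2 : ∫ v, (Set.Iic t).indicator (1 : ℝ → ℝ) v ^ 2 ∂ν ≤ 1 := by
    calc _ ≤ ∫ _v, (1 : ℝ) ∂ν := by
          refine integral_mono_of_nonneg (ae_of_all _ fun _ => sq_nonneg _) (integrable_const _)
            (ae_of_all _ fun v => ?_)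
          exact (sq_le_one_iff_abs_le_one _).2 (abs_indicator_le_one _ _)
      _ = 1 := by simp
  simp_rw [Finset.sum_sub_distrib, h1, ← countLE_eq_sum] at h
  simp only [Finset.sum_const, Finset.card_univ, Fintype.card_fin, nsmul_eq_mul] at h
  refine h.trans ?_
  gcongr
  exact mul_le_of_le_one_right (Nat.cast_nonneg _) h2

omit [IsProbabilityMeasure P] in
lemma tendsto_measure_countLE_dev (hk : Tendsto k atTop atTop)
    (hξ : ∀ n j, Measurable (ξ n j)) (hind : ∀ n, iIndepFun (ξ n) P)
    (hlaw : ∀ n j, P.map (ξ n j) = ν n) (t : ℝ) {η : ℝ} (hη : 0 < η) :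
    Tendsto (fun n => P.real {ω | k n * η ≤ |countLE (fun j => ξ n j ω) t - k n * cdf (ν n) t|})
      atTop (𝓝 0) := by
  have hinv : Tendsto (fun n => ((k n : ℝ))⁻¹ * (η ^ 2)⁻¹) atTop (𝓝 0) := by
    simpa using ((tendsto_inv_atTop_nhds_zero_nat (𝕜 := ℝ)).comp hk).mul_const ((η ^ 2)⁻¹)
  refine squeeze_zero' (Eventually.of_forall fun _ => measureReal_nonneg) ?_ hinv
  filter_upwards [hk.eventually_ge_atTop 1] with n hn
  have hk0 : (0 : ℝ) < k n := by exact_mod_cast hn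
  refine (measure_countLE_dev_le (hξ n) (hind n) (hlaw n) t (mul_pos hk0 hη)).trans_eq ?_
  field_simp

lemma tendstoInMeasure_quantile (hk : Tendsto k atTop atTop)
    (hξ : ∀ n j, Measurable (ξ n j)) (hind : ∀ n, iIndepFun (ξ n) P)
    (hlaw : ∀ n j, P.map (ξ n j) = ν n) (hQ : IsApproxQuantile P ξ l α Q)
    (hl : Tendsto (fun n => (l n : ℝ) / k n) atTop (𝓝 0)) {F : ℝ → ℝ}
    (hF : ∀ t, Tendsto (fun n => cdf (ν n) t) atTop (𝓝 (F t))) {q : ℝ}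
    (hlt : ∀ t < q, F t < α) (hgt : ∀ t > q, α < F t) :
    TendstoInMeasure P Q atTop fun _ => q := by
  have hinv : Tendsto (fun n => ((k n : ℝ))⁻¹) atTop (𝓝 0) :=
    (tendsto_inv_atTop_nhds_zero_nat (𝕜 := ℝ)).comp hk
  have hlow (t : ℝ) (ht : t < q) : Tendsto (fun n => P.real {ω | Q n ω ≤ t}) atTop (𝓝 0) := by
    set η := (α - F t) / 2 with hη
    have hη0 : 0 < η := by linarith [hlt t ht]
    refine squeeze_zero' (Eventually.of_forall fun _ => measureReal_nonneg) ?_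
      (tendsto_measure_countLE_dev hk hξ hind hlaw t hη0)
    have hlim : Tendsto (fun n => α - (l n : ℝ) / k n - cdf (ν n) t) atTop (𝓝 (α - 0 - F t)) :=
      (tendsto_const_nhds.sub hl).sub (hF t)
    filter_upwards [hk.eventually_ge_atTop 1, hQ,
      hlim.eventually (lt_mem_nhds (show η < α - 0 - F t by linarith [hlt t ht]))] with n hn hQn hln
    have hk0 : (0 : ℝ) < k n := by exact_mod_cast hn
    refine ENNReal.toReal_mono (measure_ne_top _ _) (measure_mono_ae ?_)
    filter_upwards [hQn] with ω hω hle
    have h1 := (hω t).1 hle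
    refine le_trans ?_ (le_abs_self _)
    have h2 := mul_lt_mul_of_pos_left hln hk0
    have h3 : (k n : ℝ) * (α - (l n : ℝ) / k n - cdf (ν n) t)
      = k n * α - l n - k n * cdf (ν n) t := by field_simp
    linarith
  have hup (t : ℝ) (ht : q < t) : Tendsto (fun n => P.real {ω | t < Q n ω}) atTop (𝓝 0) := by
    set η := (F t - α) / 2 with hη
    have hη0 : 0 < η := by linarith [hgt t ht]
    refine squeeze_zero' (Eventually.of_forall fun _ => measureReal_nonneg) ?_
      (tendsto_measure_countLE_dev hk hξ hind hlaw t hη0)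
    have hlim : Tendsto (fun n => cdf (ν n) t - α - (k n : ℝ)⁻¹ - (l n : ℝ) / k n) atTop
        (𝓝 (F t - α - 0 - 0)) := (((hF t).sub_const α).sub hinv).sub hl
    filter_upwards [hk.eventually_ge_atTop 1, hQ,
      hlim.eventually (lt_mem_nhds (show η < F t - α - 0 - 0 by linarith [hgt t ht]))]
      with n hn hQn hln
    have hk0 : (0 : ℝ) < k n := by exact_mod_cast hn
    refine ENNReal.toReal_mono (measure_ne_top _ _) (measure_mono_ae ?_)
    filter_upwards [hQn] with ω hω hle
    have h1 := lt_of_not_ge fun h => hle.not_ge ((hω t).2 h)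
    refine le_trans ?_ (neg_le_abs _)
    have h2 := mul_lt_mul_of_pos_left hln hk0
    have h3 : (k n : ℝ) * (cdf (ν n) t - α - (k n : ℝ)⁻¹ - (l n : ℝ) / k n)
      = k n * cdf (ν n) t - k n * α - 1 - l n := by field_simp
    linarith
  rw [tendstoInMeasure_iff_measureReal_norm]
  intro ε hε
  -- The upper event is a strict inequality, so `Q ≥ q + ε` is absorbed through the smaller level `q
  -- + ε / 2`.
  have hsum := (hlow (q - ε) (by linarith)).add (hup (q + ε / 2) (by linarith))
  rw [add_zero] at hsum
  refine squeeze_zero (fun _ => measureReal_nonneg) (fun n => ?_) hsum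
  refine (measureReal_mono (s₂ := {ω | Q n ω ≤ q - ε} ∪ {ω | q + ε / 2 < Q n ω}) ?_).trans
    (measureReal_union_le _ _)
  intro ω hω
  simp only [Set.mem_ofPred_eq, Real.norm_eq_abs, le_abs] at hω
  rcases hω with h | h
  · refine Or.inr ?_
    simp only [Set.mem_ofPred_eq]
    linarith
  · refine Or.inl ?_
    simp only [Set.mem_ofPred_eq]
    linarith

/-- For `b ≤ a` the difference takes only the values `0` and `1`, hence equals its square. -/
lemma integral_indicator_Iic_sub_sq (ν : Measure ℝ) [IsProbabilityMeasure ν] (a b : ℝ) :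
    ∫ v, ((Set.Iic a).indicator 1 v - (Set.Iic b).indicator 1 v) ^ 2 ∂ν
      = |cdf ν a - cdf ν b| := by
  have hi (t : ℝ) : Integrable ((Set.Iic t).indicator (1 : ℝ → ℝ)) ν :=
    (integrable_const (1 : ℝ)).indicator measurableSet_Iic
  have hint (a b : ℝ) : ∫ v, ((Set.Iic a).indicator (1 : ℝ → ℝ) v - (Set.Iic b).indicator 1 v) ∂ν
      = cdf ν a - cdf ν b := by
    rw [integral_sub (hi a) (hi b), integral_indicator_one measurableSet_Iic,
      integral_indicator_one measurableSet_Iic, cdf_eq_real, cdf_eq_real]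
  wlog hab : b ≤ a generalizing a b with H
  · rw [abs_sub_comm, ← H b a (le_of_not_ge hab)]
    congr 1 with v
    ring
  rw [abs_of_nonneg (sub_nonneg.2 (monotone_cdf ν hab)), ← hint]
  congr 1 with v
  simp only [Set.indicator_apply, Set.mem_Iic, Pi.one_apply]
  split_ifs <;> first | (exfalso; linarith) | norm_num

/-- The normalized number of `j` with `q < ξ j`. -/
noncomputable def upperSum {k : ℕ} (ν : Measure ℝ) (q : ℝ) (x : Fin k → ℝ) : ℝ :=
  (√(k : ℝ))⁻¹ * ∑ j, ((Set.Ioi q).indicator 1 (x j) - ν.real (Set.Ioi q))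

lemma upperSum_eq {k : ℕ} (ν : Measure ℝ) [IsProbabilityMeasure ν] (q : ℝ) (x : Fin k → ℝ) :
    upperSum ν q x = -((√(k : ℝ))⁻¹ * (countLE x q - k * cdf ν q)) := by
  have h1 (v : ℝ) : (Set.Ioi q).indicator (1 : ℝ → ℝ) v = 1 - (Set.Iic q).indicator 1 v := by
    rw [← Set.compl_Iic, Set.indicator_compl]
    simp
  have h2 : ν.real (Set.Ioi q) = 1 - cdf ν q := by
    rw [← Set.compl_Iic, probReal_compl_eq_one_sub measurableSet_Iic, cdf_eq_real]
  rw [upperSum, countLE_eq_sum]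
  simp_rw [h1, h2]
  simp only [Finset.sum_sub_distrib, Finset.sum_const, Finset.card_univ, Fintype.card_fin,
    nsmul_eq_mul]
  ring

omit [IsProbabilityMeasure P] in
lemma tight_upperSum (hk : Tendsto k atTop atTop)
    (hξ : ∀ n j, Measurable (ξ n j)) (hind : ∀ n, iIndepFun (ξ n) P)
    (hlaw : ∀ n j, P.map (ξ n j) = ν n) (q : ℝ) {δ : ℝ} (hδ : 0 < δ) :
    ∃ M > 0, ∀ᶠ n in atTop, P.real {ω | M ≤ |upperSum (ν n) q fun j => ξ n j ω|} ≤ δ := by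
  -- Chebyshev bounds the probability by `k / (√k M) ^ 2 = 1 / M ^ 2`, which is `δ` for this `M`.
  refine ⟨√(1 / δ), Real.sqrt_pos.2 (by positivity), ?_⟩
  filter_upwards [hk.eventually_ge_atTop 1] with n hn
  have hk0 : (0 : ℝ) < k n := by exact_mod_cast hn
  have hs : 0 < √(k n : ℝ) := Real.sqrt_pos.2 hk0
  have hM : 0 < √(1 / δ) := Real.sqrt_pos.2 (by positivity)
  have h := measure_countLE_dev_le (hξ n) (hind n) (hlaw n) q (mul_pos hs hM)
  have heq : {ω | √(1 / δ) ≤ |upperSum (ν n) q fun j => ξ n j ω|}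
      = {ω | √(k n : ℝ) * √(1 / δ) ≤ |countLE (fun j => ξ n j ω) q - k n * cdf (ν n) q|} := by
    ext ω
    simp only [Set.mem_ofPred_eq]
    rw [upperSum_eq, abs_neg, abs_mul, abs_of_pos (inv_pos.2 hs), le_inv_mul_iff₀ hs]
  rw [heq]
  refine h.trans_eq ?_
  rw [mul_pow, Real.sq_sqrt hk0.le, Real.sq_sqrt (by positivity)]
  field_simp

/-- The linearization of the empirical quantile at the scale `r n`. -/
lemma tendstoInMeasure_quantile_sub_upperSum (hk : Tendsto k atTop atTop)
    (hξ : ∀ n j, Measurable (ξ n j)) (hind : ∀ n, iIndepFun (ξ n) P)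
    (hlaw : ∀ n j, P.map (ξ n j) = ν n) (hQ : IsApproxQuantile P ξ l α Q)
    (hl : Tendsto (fun n => (l n : ℝ) / √(k n : ℝ)) atTop (𝓝 0)) {F : ℝ → ℝ} {q f' : ℝ}
    (hFq : F q = α) (hF : HasDerivAt F f' q) (hf' : 0 < f') {r : ℕ → ℝ}
    (hr : Tendsto r atTop atTop) {κ : ℝ} (hκ : 0 < κ)
    (hkr : Tendsto (fun n => √(k n : ℝ) / r n) atTop (𝓝 κ))
    (hrate : ∀ y, Tendsto (fun n => √(k n : ℝ) * (F (q + y / r n) - cdf (ν n) (q + y / r n)))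
      atTop (𝓝 0)) :
    TendstoInMeasure P
      (fun n ω => r n * (Q n ω - q) - (κ * f')⁻¹ * upperSum (ν n) q fun j => ξ n j ω) atTop 0 := by
  have hc0 : 0 < κ * f' := mul_pos hκ hf'
  have hsqrt : Tendsto (fun n => √(k n : ℝ)) atTop atTop :=
    Real.tendsto_sqrt_atTop.comp (tendsto_natCast_atTop_atTop.comp hk)
  have hsinv : Tendsto (fun n => (√(k n : ℝ))⁻¹) atTop (𝓝 0) := tendsto_inv_atTop_zero.comp hsqrt
  have hxn (y : ℝ) : Tendsto (fun n => q + y / r n) atTop (𝓝 q) := by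
    simpa using (hr.const_div_atTop y).const_add q
  have hFn (y : ℝ) : Tendsto (fun n => cdf (ν n) (q + y / r n)) atTop (𝓝 α) := by
    have h1 := hsinv.mul (hrate y)
    have h2 := (hF.continuousAt.tendsto.comp (hxn y)).sub h1
    rw [hFq, mul_zero, sub_zero] at h2
    refine h2.congr' ?_
    filter_upwards [hsqrt.eventually_gt_atTop 0] with n hn
    simp only [Function.comp_apply]
    field_simp
    ring
  -- Split `α - F_n` as `(F - F_n) - (F - F q)` at the moving point: the first part is negligible by
  -- the rate, the second contributes `κ` times the derivative in direction `y`.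
  have hdrift (y : ℝ) : Tendsto (fun n => √(k n : ℝ) * (α - cdf (ν n) (q + y / r n))) atTop
      (𝓝 (-(κ * f' * y))) := by
    have h1 : Tendsto (fun n => r n * (F (q + y / r n) - F q)) atTop (𝓝 (f' * y)) := by
      have := hF.hasFDerivAt.lim y (c := r) (tendsto_norm_atTop_atTop.comp hr)
      simpa [mul_comm, div_eq_inv_mul] using this
    have h2 := (hrate y).sub (hkr.mul h1)
    rw [zero_sub, ← mul_assoc] at h2
    refine h2.congr' ?_
    filter_upwards [hr.eventually_gt_atTop 0] with n hn
    rw [hFq]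
    field_simp
    ring
  -- Asymptotic equicontinuity of the empirical process: Chebyshev gives the bound `|F_n(q + y / r
  -- n) - F_n(q)| / η ^ 2`, and both values tend to `α`.
  have hΔ (y η : ℝ) (hη : 0 < η) : Tendsto (fun n => P.real {ω | √(k n : ℝ) * η ≤
      |(countLE (fun j => ξ n j ω) (q + y / r n) - k n * cdf (ν n) (q + y / r n))
        - (countLE (fun j => ξ n j ω) q - k n * cdf (ν n) q)|}) atTop (𝓝 0) := by
    have hlim : Tendsto (fun n => |cdf (ν n) (q + y / r n) - cdf (ν n) q| / η ^ 2) atTop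
        (𝓝 0) := by
      have h0 : Tendsto (fun n => cdf (ν n) q) atTop (𝓝 α) := by simpa using hFn 0
      simpa using (((hFn y).sub h0).abs).div_const (η ^ 2)
    refine squeeze_zero' (Eventually.of_forall fun _ => measureReal_nonneg) ?_ hlim
    filter_upwards [hk.eventually_ge_atTop 1] with n hn
    have hk0 : (0 : ℝ) < k n := by exact_mod_cast hn
    have hs : 0 < √(k n : ℝ) := Real.sqrt_pos.2 hk0
    set a := q + y / r n
    have hm : Measurable fun v : ℝ => (Set.Iic a).indicator (1 : ℝ → ℝ) v
        - (Set.Iic q).indicator 1 v :=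
      (measurable_indicator_Iic a).sub (measurable_indicator_Iic q)
    have hi (t : ℝ) : Integrable ((Set.Iic t).indicator (1 : ℝ → ℝ)) (ν n) :=
      (integrable_const (1 : ℝ)).indicator measurableSet_Iic
    have h := measure_le_abs_sum_sub_le (hξ n) (hind n) (hlaw n) hm (C := 2)
      (fun v => (abs_sub _ _).trans (by
        linarith [abs_indicator_le_one (Set.Iic a) v, abs_indicator_le_one (Set.Iic q) v]))
      (mul_pos hs hη)
    rw [integral_indicator_Iic_sub_sq, integral_sub (hi a) (hi q),
      integral_indicator_one measurableSet_Iic, integral_indicator_one measurableSet_Iic,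
      ← cdf_eq_real, ← cdf_eq_real] at h
    have heq (ω : Ω) : ∑ j, ((Set.Iic a).indicator (1 : ℝ → ℝ) (ξ n j ω)
        - (Set.Iic q).indicator 1 (ξ n j ω) - (cdf (ν n) a - cdf (ν n) q))
        = (countLE (fun j => ξ n j ω) a - k n * cdf (ν n) a)
          - (countLE (fun j => ξ n j ω) q - k n * cdf (ν n) q) := by
      rw [countLE_eq_sum, countLE_eq_sum]
      simp only [Finset.sum_sub_distrib, Finset.sum_const, Finset.card_univ, Fintype.card_fin,
        nsmul_eq_mul]
      ring
    simp_rw [heq] at h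
    refine h.trans_eq ?_
    rw [mul_pow, Real.sq_sqrt hk0.le]
    field_simp
  refine tendstoInMeasure_sub_of_separated ?_ ?_ ?_
  · intro δ hδ
    obtain ⟨M, hM0, hM⟩ := tight_upperSum hk hξ hind hlaw q hδ
    refine ⟨(κ * f')⁻¹ * M, ?_⟩
    filter_upwards [hM] with n hn
    refine le_trans (measureReal_mono ?_) hn
    intro ω hω
    simp only [Set.mem_ofPred_eq] at hω ⊢
    rw [abs_mul, abs_of_pos (inv_pos.2 hc0)] at hω
    exact le_of_mul_le_mul_left hω (inv_pos.2 hc0)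
  · intro y ε hε
    -- On the bad event the centred counts at the moving level and at `q` are about `√k κ f' ε`
    -- apart. Half of this is given to the errors in the drift and the contamination.
    have hη : 0 < κ * f' * ε / 2 := by positivity
    refine squeeze_zero' (Eventually.of_forall fun _ => measureReal_nonneg) ?_ (hΔ y _ hη)
    have hlim := (hdrift y).sub hl
    filter_upwards [hk.eventually_ge_atTop 1, hr.eventually_gt_atTop 0, hQ, hlim.eventually
      (lt_mem_nhds (show -(κ * f' * y) - κ * f' * ε / 2 < -(κ * f' * y) - 0 by linarith))]
      with n hn hrn hQn hln
    have hk0 : (0 : ℝ) < k n := by exact_mod_cast hn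
    have hs : 0 < √(k n : ℝ) := Real.sqrt_pos.2 hk0
    refine ENNReal.toReal_mono (measure_ne_top _ _) (measure_mono_ae ?_)
    filter_upwards [hQn] with ω hω hle
    obtain ⟨hV, hW⟩ := hle
    have hx : Q n ω ≤ q + y / r n := by
      rw [← sub_le_iff_le_add', le_div_iff₀' hrn]
      exact hV
    have h1 := (hω _).1 hx
    rw [le_inv_mul_iff₀ hc0, upperSum_eq, ← mul_neg, le_inv_mul_iff₀ hs] at hW
    have h2 := mul_lt_mul_of_pos_left hln hs
    have h3 : √(k n : ℝ) * (√(k n : ℝ) * (α - cdf (ν n) (q + y / r n)) - l n / √(k n : ℝ))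
        = k n * α - k n * cdf (ν n) (q + y / r n) - l n := by
      rw [mul_sub, ← mul_assoc, Real.mul_self_sqrt hk0.le]
      field_simp
    rw [h3] at h2
    refine le_trans ?_ (le_abs_self _)
    nlinarith
  · intro y ε hε
    have hη : 0 < κ * f' * ε / 2 := by positivity
    refine squeeze_zero' (Eventually.of_forall fun _ => measureReal_nonneg) ?_ (hΔ y _ hη)
    -- The term `1 / √k` accounts for the rounding `+ 1` in the second clause of `IsApproxQuantile`.
    have hlim := ((hdrift y).add hl).add hsinv
    filter_upwards [hk.eventually_ge_atTop 1, hr.eventually_gt_atTop 0, hQ, hlim.eventually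
      (gt_mem_nhds (show -(κ * f' * y) + 0 + 0 < -(κ * f' * y) + κ * f' * ε / 2 by linarith))]
      with n hn hrn hQn hln
    have hk0 : (0 : ℝ) < k n := by exact_mod_cast hn
    have hs : 0 < √(k n : ℝ) := Real.sqrt_pos.2 hk0
    refine ENNReal.toReal_mono (measure_ne_top _ _) (measure_mono_ae ?_)
    filter_upwards [hQn] with ω hω hle
    obtain ⟨hV, hW⟩ := hle
    have hx : q + y / r n < Q n ω := by
      rw [← lt_sub_iff_add_lt', div_lt_iff₀' hrn]
      exact hV
    have h1 := lt_of_not_ge fun h => hx.not_ge ((hω _).2 h)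
    rw [inv_mul_le_iff₀ hc0, upperSum_eq, ← mul_neg, inv_mul_le_iff₀ hs] at hW
    have h2 := mul_lt_mul_of_pos_left hln hs
    have h3 : √(k n : ℝ) * (√(k n : ℝ) * (α - cdf (ν n) (q + y / r n)) + l n / √(k n : ℝ)
          + (√(k n : ℝ))⁻¹) = k n * α - k n * cdf (ν n) (q + y / r n) + l n + 1 := by
      rw [mul_add, mul_add, ← mul_assoc, Real.mul_self_sqrt hk0.le]
      field_simp
    rw [h3] at h2
    refine le_trans ?_ (neg_le_abs _)
    nlinarith

/-- The linearization of the empirical quantile, at a scale equivalent to `κ r n`. -/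
lemma tendstoInMeasure_scaled_quantile_sub_upperSum (hk : Tendsto k atTop atTop)
    (hξ : ∀ n j, Measurable (ξ n j)) (hind : ∀ n, iIndepFun (ξ n) P)
    (hlaw : ∀ n j, P.map (ξ n j) = ν n) {q f' : ℝ} {r R : ℕ → ℝ}
    (hr : Tendsto r atTop atTop) {κ : ℝ} (hκ : 0 < κ)
    (hRr : Tendsto (fun n => R n / r n) atTop (𝓝 κ))
    (h : TendstoInMeasure P (fun n ω => r n * (Q n ω - q)
      - (κ * f')⁻¹ * upperSum (ν n) q fun j => ξ n j ω) atTop 0) :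
    TendstoInMeasure P (fun n ω => R n * (Q n ω - q)
      - f'⁻¹ * upperSum (ν n) q fun j => ξ n j ω) atTop 0 := by
  rw [tendstoInMeasure_iff_measureReal_norm] at h ⊢
  intro ε hε
  rw [tendsto_order]
  refine ⟨fun a ha => Eventually.of_forall fun n => ha.trans_le measureReal_nonneg, fun a ha => ?_⟩
  obtain ⟨M, hM0, hM⟩ := tight_upperSum hk hξ hind hlaw q (half_pos ha)
  -- Since eventually `R / r < 2κ`, this threshold leaves an error of at most `ε / 2` after
  -- rescaling; tightness of `upperSum` controls the remaining half.
  have h1 := h (ε / (4 * κ)) (by positivity)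
  have hsmall : Tendsto (fun n => |(R n / r n - κ) * (κ * f')⁻¹| * M) atTop (𝓝 0) := by
    simpa using (((hRr.sub_const κ).mul_const ((κ * f')⁻¹)).abs).mul_const M
  filter_upwards [h1.eventually (gt_mem_nhds (half_pos ha)), hM, hr.eventually_gt_atTop 0,
    hsmall.eventually (gt_mem_nhds (half_pos hε)),
    hRr.eventually (gt_mem_nhds (show κ < 2 * κ by linarith)),
    hRr.eventually (lt_mem_nhds hκ)] with n hn1 hn2 hrn hn3 hn4 hn5
  refine lt_of_le_of_lt ((measureReal_mono ?_).trans (measureReal_union_le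
    {ω | ε / (4 * κ) ≤ ‖r n * (Q n ω - q) - (κ * f')⁻¹ * (upperSum (ν n) q fun j => ξ n j ω)
      - (0 : Ω → ℝ) ω‖}
    {ω | M ≤ |upperSum (ν n) q fun j => ξ n j ω|})) (by linarith)
  intro ω hω
  by_contra hc
  simp only [Set.mem_union, Set.mem_ofPred_eq, not_or, not_le, Pi.zero_apply, sub_zero,
    Real.norm_eq_abs] at hc hω
  set U := upperSum (ν n) q fun j => ξ n j ω
  have hid : R n * (Q n ω - q) - f'⁻¹ * U
      = R n / r n * (r n * (Q n ω - q) - (κ * f')⁻¹ * U)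
        + (R n / r n - κ) * (κ * f')⁻¹ * U := by
    rw [mul_inv]
    field_simp
    ring
  have hA : |R n / r n * (r n * (Q n ω - q) - (κ * f')⁻¹ * U)| ≤ 2 * κ * (ε / (4 * κ)) := by
    rw [abs_mul, abs_of_pos hn5]
    gcongr
    exact hc.1.le
  have hB : |(R n / r n - κ) * (κ * f')⁻¹ * U| ≤ |(R n / r n - κ) * (κ * f')⁻¹| * M := by
    rw [abs_mul]
    gcongr
    exact hc.2.le
  have hE : 2 * κ * (ε / (4 * κ)) = ε / 2 := by field_simp; norm_num
  rw [hid] at hω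
  have := hω.trans (abs_add_le _ _)
  linarith

end

/-! ### Growth of the number and size of blocks -/

section Rates

variable {c β : ℝ}

lemma tendsto_natCast_rpow_atTop (hβ : 0 < β) :
    Tendsto (fun n : ℕ => (n : ℝ) ^ β) atTop atTop :=
  (tendsto_rpow_atTop hβ).comp tendsto_natCast_atTop_atTop

lemma tendsto_numBlocks_atTop (hc : 0 < c) (hβ : 0 < β) : Tendsto (numBlocks c β) atTop atTop :=
  tendsto_nat_floor_atTop.comp ((tendsto_natCast_rpow_atTop hβ).const_mul_atTop hc)

lemma tendsto_blockSize_atTop (hc : 0 < c) (hβ : β < 1) : Tendsto (blockSize c β) atTop atTop := by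
  refine tendsto_nat_floor_atTop.comp ?_
  refine ((tendsto_natCast_rpow_atTop (sub_pos.2 hβ)).const_mul_atTop (inv_pos.2 hc)).congr' ?_
  filter_upwards [eventually_gt_atTop 0] with n hn
  have hn' : (0 : ℝ) < n := by exact_mod_cast hn
  rw [Real.rpow_sub hn', Real.rpow_one]
  field_simp

/-- This places all blocks inside the first `n` observations, where the contamination bound applies.
-/
lemma numBlocks_mul_blockSize_le (hc : 0 < c) (β : ℝ) (n : ℕ) :
    numBlocks c β n * blockSize c β n ≤ n := by
  have h0 : 0 ≤ c * (n : ℝ) ^ β := by positivity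
  have h1 : (numBlocks c β n : ℝ) ≤ c * (n : ℝ) ^ β := Nat.floor_le h0
  have h2 : (blockSize c β n : ℝ) ≤ n / (c * (n : ℝ) ^ β) := Nat.floor_le (by positivity)
  have h3 : (numBlocks c β n : ℝ) * blockSize c β n ≤ n := by
    calc _ ≤ c * (n : ℝ) ^ β * (n / (c * (n : ℝ) ^ β)) := by gcongr
      _ ≤ n := by
        rcases h0.eq_or_lt with h | h
        · rw [← h]; simp
        · rw [mul_div_cancel₀ _ h.ne']
  exact_mod_cast h3

lemma tendsto_numBlocks_div_rpow (hc : 0 < c) (hβ : 0 < β) :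
    Tendsto (fun n : ℕ => (numBlocks c β n : ℝ) / (n : ℝ) ^ β) atTop (𝓝 c) :=
  (tendsto_nat_floor_mul_div_atTop hc.le).comp (tendsto_natCast_rpow_atTop hβ)

lemma tendsto_floor_div_rpow (hβ : 0 < β) :
    Tendsto (fun n : ℕ => (⌊(n : ℝ) ^ β⌋₊ : ℝ) / (n : ℝ) ^ β) atTop (𝓝 1) :=
  tendsto_nat_floor_div_atTop.comp (tendsto_natCast_rpow_atTop hβ)

lemma tendsto_sqrt_numBlocks_div_sqrt_rpow (hc : 0 < c) (hβ : 0 < β) :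
    Tendsto (fun n : ℕ => √(numBlocks c β n : ℝ) / √((n : ℝ) ^ β)) atTop (𝓝 √c) := by
  refine ((Real.continuous_sqrt.tendsto c).comp (tendsto_numBlocks_div_rpow hc hβ)).congr
    fun n => ?_
  simp only [Function.comp_apply]
  rw [Real.sqrt_div (Nat.cast_nonneg _)]

lemma tendsto_sqrt_rpow_div_sqrt_floor (hβ : 0 < β) :
    Tendsto (fun n : ℕ => √((n : ℝ) ^ β) / √(⌊(n : ℝ) ^ β⌋₊ : ℝ)) atTop (𝓝 1) := by
  have h := ((Real.continuous_sqrt.tendsto 1).comp (tendsto_floor_div_rpow hβ)).inv₀ (by simp)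
  rw [Real.sqrt_one, inv_one] at h
  refine h.congr fun n => ?_
  simp only [Function.comp_apply]
  rw [Real.sqrt_div (Nat.cast_nonneg _), inv_div]

lemma tendsto_sqrt_numBlocks_div_sqrt_floor (hc : 0 < c) (hβ : 0 < β) :
    Tendsto (fun n : ℕ => √(numBlocks c β n : ℝ) / √(⌊(n : ℝ) ^ β⌋₊ : ℝ)) atTop (𝓝 √c) := by
  have h := (tendsto_sqrt_numBlocks_div_sqrt_rpow hc hβ).mul (tendsto_sqrt_rpow_div_sqrt_floor hβ)
  rw [mul_one] at h
  refine h.congr' ?_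
  filter_upwards [eventually_gt_atTop 0] with n hn
  have : 0 < √((n : ℝ) ^ β) := Real.sqrt_pos.2 (by positivity)
  field_simp

lemma tendsto_sqrt_scale_div_sqrt_floor (hc : 0 < c) (hβ : 0 < β) :
    Tendsto (fun n : ℕ => √(c * (n : ℝ) ^ β) / √(⌊(n : ℝ) ^ β⌋₊ : ℝ)) atTop (𝓝 √c) := by
  have h := (tendsto_sqrt_rpow_div_sqrt_floor hβ).const_mul √c
  rw [mul_one] at h
  refine h.congr fun n => ?_
  rw [Real.sqrt_mul hc.le, mul_div_assoc]

lemma tendsto_sqrt_floor_atTop (hβ : 0 < β) :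
    Tendsto (fun n : ℕ => √(⌊(n : ℝ) ^ β⌋₊ : ℝ)) atTop atTop :=
  Real.tendsto_sqrt_atTop.comp (tendsto_natCast_atTop_atTop.comp
    (tendsto_nat_floor_atTop.comp (tendsto_natCast_rpow_atTop hβ)))

lemma tendsto_div_rpow_of_isBigO {l : ℕ → ℕ} {γ : ℝ}
    (hl : (fun n => (l n : ℝ)) =O[atTop] fun n : ℕ => (n : ℝ) ^ γ) {b : ℝ} (hb : γ < b) :
    Tendsto (fun n => (l n : ℝ) / (n : ℝ) ^ b) atTop (𝓝 0) := by
  have h : (fun n => (l n : ℝ) / (n : ℝ) ^ b) =O[atTop] fun n : ℕ => (n : ℝ) ^ γ / (n : ℝ) ^ b :=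
    hl.mul (Asymptotics.isBigO_refl _ _)
  refine h.trans_tendsto ?_
  refine ((tendsto_rpow_neg_atTop (sub_pos.2 hb)).comp tendsto_natCast_atTop_atTop).congr' ?_
  filter_upwards [eventually_gt_atTop 0] with n hn
  have hn' : (0 : ℝ) < n := by exact_mod_cast hn
  simp only [Function.comp_apply]
  rw [← Real.rpow_sub hn', neg_sub]

lemma tendsto_div_numBlocks (hc : 0 < c) (hβ : 0 < β) {l : ℕ → ℕ} {γ : ℝ}
    (hl : (fun n => (l n : ℝ)) =O[atTop] fun n : ℕ => (n : ℝ) ^ γ) (hγ : γ < β) :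
    Tendsto (fun n => (l n : ℝ) / numBlocks c β n) atTop (𝓝 0) := by
  have h := (tendsto_div_rpow_of_isBigO hl hγ).div (tendsto_numBlocks_div_rpow hc hβ) hc.ne'
  rw [zero_div] at h
  refine h.congr' ?_
  filter_upwards [eventually_gt_atTop 0] with n hn
  have hn' : (n : ℝ) ^ β ≠ 0 := by positivity
  exact div_div_div_cancel_right₀ hn' _ _

/-- As `√k` has order `n ^ (β / 2)`, contamination is invisible at the central limit scale once `2γ
< β`. -/
lemma tendsto_div_sqrt_numBlocks (hc : 0 < c) (hβ : 0 < β) {l : ℕ → ℕ} {γ : ℝ}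
    (hl : (fun n => (l n : ℝ)) =O[atTop] fun n : ℕ => (n : ℝ) ^ γ) (hγ : 2 * γ < β) :
    Tendsto (fun n => (l n : ℝ) / √(numBlocks c β n : ℝ)) atTop (𝓝 0) := by
  have h := (tendsto_div_rpow_of_isBigO hl (show γ < β / 2 by linarith)).div
    (tendsto_sqrt_numBlocks_div_sqrt_rpow hc hβ) (Real.sqrt_pos.2 hc).ne'
  rw [zero_div] at h
  refine h.congr' ?_
  filter_upwards [eventually_gt_atTop 0] with n hn
  have hn' : (n : ℝ) ^ (β / 2) ≠ 0 := by positivity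
  have hs : √((n : ℝ) ^ β) = (n : ℝ) ^ (β / 2) := by
    rw [Real.sqrt_eq_rpow, ← Real.rpow_mul (Nat.cast_nonneg _)]
    congr 1
    ring
  simp only [Pi.div_apply]
  rw [hs]
  exact div_div_div_cancel_right₀ hn' _ _

lemma LocalRate.tendsto_sqrt_numBlocks (hc : 0 < c) (hβ : 0 < β) {F : ℝ → ℝ} {Fn : ℕ → ℝ → ℝ}
    {q : ℝ} (h : LocalRate F Fn q β) (y : ℝ) :
    Tendsto (fun n : ℕ => √(numBlocks c β n : ℝ) * (F (q + y / √(⌊(n : ℝ) ^ β⌋₊ : ℝ))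
      - Fn n (q + y / √(⌊(n : ℝ) ^ β⌋₊ : ℝ)))) atTop (𝓝 0) := by
  have h1 := (tendsto_sqrt_numBlocks_div_sqrt_rpow hc hβ).mul (h y)
  rw [mul_zero] at h1
  refine h1.congr' ?_
  filter_upwards [eventually_gt_atTop 0] with n hn
  have : 0 < √((n : ℝ) ^ β) := Real.sqrt_pos.2 (by positivity)
  field_simp

end Rates

/-! ### Block estimates and the effect of contamination -/

section BlockEstimates

variable {Ω E : Type*} [MeasurableSpace Ω] [MeasurableSpace E] {P : Measure Ω} {d : ℕ}
  {X : ℕ → Ω → E} {Z : (m : ℕ) → (Fin m → E) → EuclideanSpace ℝ (Fin d)}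

omit [MeasurableSpace E] in
-- Choosing one altered position in each altered block is injective, because the blocks are
-- disjoint.
lemma ncard_ne_block_le {x y : ℕ → E} {k m n l : ℕ} (hkm : k * m ≤ n)
    (h : {i : ℕ | i < n ∧ y i ≠ x i}.ncard ≤ l) :
    {j : Fin k | block m j y ≠ block m j x}.ncard ≤ l := by
  classical
  -- The position is a natural number, not an element of `Fin m`, so that unaltered blocks have a
  -- default value even when `m = 0`.
  have hex (j : Fin k) : ∃ a : ℕ, block m j y ≠ block m j x →
      a < m ∧ y ((j : ℕ) * m + a) ≠ x ((j : ℕ) * m + a) := by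
    by_cases hj : block m j y = block m j x
    · exact ⟨0, fun h => absurd hj h⟩
    · obtain ⟨a, ha⟩ := Function.ne_iff.1 hj
      exact ⟨a, fun _ => ⟨a.2, ha⟩⟩
  choose g hg using hex
  refine le_trans (Set.ncard_le_ncard_of_injOn (fun j : Fin k => (j : ℕ) * m + g j) ?_ ?_
    ((Set.finite_lt_nat n).subset fun i hi => hi.1)) h
  · intro j hj
    obtain ⟨h1, h2⟩ := hg j hj
    refine ⟨lt_of_lt_of_le ?_ hkm, h2⟩
    calc (j : ℕ) * m + g j < (j : ℕ) * m + m := by omega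
      _ = (j + 1) * m := by ring
      _ ≤ k * m := Nat.mul_le_mul_right _ j.2
  · intro i hi j hj hij
    have := block_index_injective k m (a₁ := (i, ⟨g i, (hg i hi).1⟩))
      (a₂ := (j, ⟨g j, (hg j hj).1⟩)) hij
    exact congrArg Prod.fst this

/-- The rescaled estimate computed from the `j`-th block of the uncontaminated sample. -/
def rescaledBlock (X : ℕ → Ω → E) (Z : (m : ℕ) → (Fin m → E) → EuclideanSpace ℝ (Fin d))
    (θ₀ : EuclideanSpace ℝ (Fin d)) (a : ℕ → ℝ) (m j : ℕ) (ω : Ω) : EuclideanSpace ℝ (Fin d) :=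
  a m • (Z m (block m j fun i => X i ω) - θ₀)

lemma measurable_rescaledBlock (hX : ∀ i, Measurable (X i)) (hZ : ∀ m, Measurable (Z m))
    (θ₀ : EuclideanSpace ℝ (Fin d)) (a : ℕ → ℝ) (m j : ℕ) :
    Measurable (rescaledBlock X Z θ₀ a m j) :=
  (((hZ m).comp (measurable_block hX m j)).sub_const θ₀).const_smul (a m)

lemma iIndepFun_rescaledBlock (hX : ∀ i, Measurable (X i)) (hind : iIndepFun X P)
    (hZ : ∀ m, Measurable (Z m)) (θ₀ : EuclideanSpace ℝ (Fin d)) (a : ℕ → ℝ) (k m : ℕ) :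
    iIndepFun (fun j : Fin k => rescaledBlock X Z θ₀ a m j) P :=
  (iIndepFun_block hX hind k m).comp (fun _ x => a m • (Z m x - θ₀))
    fun _ => ((hZ m).sub_const θ₀).const_smul (a m)

lemma map_rescaledBlock (hX : ∀ i, Measurable (X i)) (hind : iIndepFun X P)
    (hid : ∀ i, IdentDistrib (X i) (X 0) P P) (hZ : ∀ m, Measurable (Z m))
    (θ₀ : EuclideanSpace ℝ (Fin d)) (a : ℕ → ℝ) (m j : ℕ) :
    P.map (rescaledBlock X Z θ₀ a m j) = P.map (rescaled X Z θ₀ a m) := by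
  have hg : Measurable fun x => a m • (Z m x - θ₀) := ((hZ m).sub_const θ₀).const_smul (a m)
  have h (j : ℕ) : P.map (rescaledBlock X Z θ₀ a m j)
      = (P.map fun ω => block m j fun i => X i ω).map fun x => a m • (Z m x - θ₀) := by
    rw [Measure.map_map hg (measurable_block hX m j)]
    rfl
  rw [h, map_block_eq hX hind hid, ← h]
  rfl

omit [MeasurableSpace E] in
-- The reduction from contaminated blocks to the clean array: the two families of estimates differ
-- at no more than `l n` indices. Large `n` ensures at least one block, so that the ranks are valid,
-- and `a m > 0`, so that rescaling preserves order.
lemma isApproxQuantile_of_isBlockEstimate {l : ℕ → ℕ} {Xt : ℕ → ℕ → Ω → E}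
    (hXt : IsContamination P X l Xt) {c β : ℝ} (hc : 0 < c) (hβ : β ∈ Set.Ioo (0 : ℝ) 1)
    {Zt : (n : ℕ) → Fin (numBlocks c β n) → Ω → EuclideanSpace ℝ (Fin d)}
    (hZt : ∀ n, IsBlockEstimate P X Z (Xt n) (numBlocks c β n) (blockSize c β n) (Zt n))
    (θ₀ : EuclideanSpace ℝ (Fin d)) {a : ℕ → ℝ} (ha : Tendsto a atTop atTop) {α : ℝ}
    (hα : α ∈ Set.Ioo (0 : ℝ) 1) (i : Fin d) :
    IsApproxQuantile P
      (fun n (j : Fin (numBlocks c β n)) ω => rescaledBlock X Z θ₀ a (blockSize c β n) j ω i) l α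
      (fun n ω => a (blockSize c β n) * (sampleQuantile α (fun j => Zt n j ω i) - θ₀ i)) := by
  filter_upwards [(tendsto_numBlocks_atTop hc hβ.1).eventually_ge_atTop 1,
    (ha.comp (tendsto_blockSize_atTop hc hβ.2)).eventually_gt_atTop 0] with n hk ham
  simp only [Function.comp_apply] at ham
  filter_upwards [hXt n, ae_all_iff.2 fun j => (hZt n j).2] with ω hω hZω t
  have hne : {j : Fin (numBlocks c β n) | a (blockSize c β n) * (Zt n j ω i - θ₀ i)
      ≠ rescaledBlock X Z θ₀ a (blockSize c β n) j ω i}.ncard ≤ l n := by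
    refine le_trans (Set.ncard_le_ncard ?_ (Set.toFinite _))
      (ncard_ne_block_le (numBlocks_mul_blockSize_le hc β n) hω)
    intro j hj hb
    refine hj ?_
    rw [hZω j hb, hb]
    rfl
  have hne' : {j : Fin (numBlocks c β n) | rescaledBlock X Z θ₀ a (blockSize c β n) j ω i
      ≠ a (blockSize c β n) * (Zt n j ω i - θ₀ i)}.ncard ≤ l n := by
    simpa only [ne_comm] using hne
  rw [← sampleQuantile_mul_sub _ hα hk ham]
  constructor
  · intro h
    refine (mul_le_card_of_sampleQuantile_le hα hk h).trans ?_
    exact_mod_cast card_le_card_add_of_ncard_ne_le hne t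
  · intro h
    refine sampleQuantile_le_of_le_card hα hk ?_
    have h2 : (countLE (fun j : Fin (numBlocks c β n) =>
        rescaledBlock X Z θ₀ a (blockSize c β n) j ω i) t : ℝ)
        ≤ (Finset.univ.filter fun j => a (blockSize c β n) * (Zt n j ω i - θ₀ i) ≤ t).card
          + l n := by
      exact_mod_cast card_le_card_add_of_ncard_ne_le hne' t
    linarith

lemma measurable_compQuantile {k : ℕ} (α : Fin d → ℝ) :
    Measurable fun z : Fin k → EuclideanSpace ℝ (Fin d) => compQuantile α z := by
  refine (WithLp.measurable_toLp 2 _).comp (measurable_pi_lambda _ fun i => ?_)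
  refine (measurable_sampleQuantile (α i)).comp (measurable_pi_lambda _ fun j => ?_)
  fun_prop

end BlockEstimates

lemma localRate_of_lt_betaStar {Ω Ω' E : Type*} [MeasurableSpace Ω] [MeasurableSpace Ω'] {d : ℕ}
    {P : Measure Ω} {P' : Measure Ω'} {X : ℕ → Ω → E}
    {Z : (m : ℕ) → (Fin m → E) → EuclideanSpace ℝ (Fin d)}
    {θ₀ : EuclideanSpace ℝ (Fin d)} {a : ℕ → ℝ} {Y : Ω' → EuclideanSpace ℝ (Fin d)}
    {α : Fin d → ℝ} {c : ℝ} {i : Fin d} {β : ℝ} (hβ : 0 < β)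
    (h : β < betaStar P P' X Z θ₀ a Y α c i) :
    LocalRate (margCdf P' Y i) (fun n => margCdf P (rescaled X Z θ₀ a (blockSize c β n)) i)
      (margQuantile P' Y α i) β := by
  rcases Set.eq_empty_or_nonempty {β : ℝ | β ∈ Set.Ioo (0 : ℝ) 1 ∧ ∀ b ∈ Set.Ioc (0 : ℝ) β,
    LocalRate (margCdf P' Y i)
      (fun n => margCdf P (rescaled X Z θ₀ a (blockSize c b n)) i) (margQuantile P' Y α i) b}
    with he | hne
  -- With no admissible exponent the supremum is `0`, contradicting `0 < β`.
  · rw [betaStar, he, Real.sSup_empty] at h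
    exact absurd h hβ.not_gt
  · obtain ⟨b, hb, hlt⟩ := exists_lt_of_lt_csSup hne h
    exact hb.2 β ⟨hβ, hlt.le⟩

/-! ### Marginal laws of the limit vector -/

section Marginals

variable {Ω : Type*} [MeasurableSpace Ω] {P : Measure Ω} {d : ℕ}
  {Y : Ω → EuclideanSpace ℝ (Fin d)}

lemma aemeasurable_coord (hY : AEMeasurable Y P) (i : Fin d) : AEMeasurable (fun ω => Y ω i) P :=
  (show Measurable fun v : EuclideanSpace ℝ (Fin d) => v i by fun_prop).comp_aemeasurable hY

lemma map_coord (hY : AEMeasurable Y P) (i : Fin d) :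
    (P.map Y).map (fun v => v i) = P.map fun ω => Y ω i :=
  AEMeasurable.map_map_of_aemeasurable
    (show Measurable fun v : EuclideanSpace ℝ (Fin d) => v i by fun_prop).aemeasurable hY

lemma map_coord_eq_null_of_density (hY : AEMeasurable Y P) {i : Fin d} {f : ℝ → ℝ}
    (hf : IsDensity P (fun ω => Y ω i) f) (x : ℝ) : P.map Y {v | v i = x} = 0 := by
  have hm : Measurable fun v : EuclideanSpace ℝ (Fin d) => v i := by fun_prop
  have h : (P.map fun ω => Y ω i) {x} = 0 := by
    rw [hf.2.2]
    exact withDensity_absolutelyContinuous _ _ (Real.volume_singleton)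
  rw [← map_coord hY i, Measure.map_apply hm (measurableSet_singleton x)] at h
  exact h

variable [IsProbabilityMeasure P]

lemma margCdf_eq_real (hY : AEMeasurable Y P) (i : Fin d) (x : ℝ) :
    margCdf P Y i x = (P.map Y).real {v | v i ≤ x} := by
  have hm : Measurable fun v : EuclideanSpace ℝ (Fin d) => v i := by fun_prop
  have := Measure.isProbabilityMeasure_map (μ := P) (aemeasurable_coord hY i)
  rw [margCdf, cdf_eq_real, ← map_coord hY i, map_measureReal_apply hm measurableSet_Iic]
  rfl

lemma margCdf_margQuantile (hY : AEMeasurable Y P) {i : Fin d} {f : ℝ → ℝ}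
    (hf : IsDensity P (fun ω => Y ω i) f) {α : Fin d → ℝ} (hα : α i ∈ Set.Ioo (0 : ℝ) 1) :
    margCdf P Y i (margQuantile P Y α i) = α i := by
  have := Measure.isProbabilityMeasure_map (μ := P) (aemeasurable_coord hY i)
  exact cdf_quantileFn (continuous_cdf hf.1 hf.2.1 hf.2.2) hα

lemma map_real_margQuantile_lt (hY : AEMeasurable Y P) {i : Fin d} {f : ℝ → ℝ}
    (hf : IsDensity P (fun ω => Y ω i) f) {α : Fin d → ℝ} (hα : α i ∈ Set.Ioo (0 : ℝ) 1) :
    (P.map Y).real {v | margQuantile P Y α i < v i} = 1 - α i := by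
  have := Measure.isProbabilityMeasure_map (μ := P) hY
  have hm : MeasurableSet {v : EuclideanSpace ℝ (Fin d) | v i ≤ margQuantile P Y α i} :=
    measurableSet_le (by fun_prop) measurable_const
  have h : {v : EuclideanSpace ℝ (Fin d) | margQuantile P Y α i < v i}
      = {v | v i ≤ margQuantile P Y α i}ᶜ := by
    ext v
    simp
  rw [h, probReal_compl_eq_one_sub hm, ← margCdf_eq_real hY, margCdf_margQuantile hY hf hα]

lemma asympCov_eq_upperCov (hY : AEMeasurable Y P) {f : Fin d → ℝ → ℝ}
    (hf : ∀ i, IsDensity P (fun ω => Y ω i) (f i)) {α : Fin d → ℝ}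
    (hα : ∀ i, α i ∈ Set.Ioo (0 : ℝ) 1) :
    asympCov P Y f α
      = upperCov (P.map Y) (margQuantile P Y α) fun i => f i (margQuantile P Y α i) := by
  ext i j
  have hS : MeasurableSet {v : EuclideanSpace ℝ (Fin d) |
      margQuantile P Y α i < v i ∧ margQuantile P Y α j < v j} :=
    (measurableSet_lt_coord i _).inter (measurableSet_lt_coord j _)
  simp only [asympCov, upperCov, Matrix.of_apply]
  rw [map_real_margQuantile_lt hY (hf i) (hα i), map_real_margQuantile_lt hY (hf j) (hα j),
    map_measureReal_apply_of_aemeasurable hY hS]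
  rfl

end Marginals

/-- This matches the scalar sums of the linearization with the coordinates of a single vector sum,
which is how coordinate-wise approximations yield a joint limit. -/
lemma upperScore_sum_coord {d k : ℕ} {ν : Measure (EuclideanSpace ℝ (Fin d))}
    {q s : Fin d → ℝ} (x : Fin k → EuclideanSpace ℝ (Fin d)) (i : Fin d) :
    ((√(k : ℝ))⁻¹ • ∑ j, upperScore ν q s (x j)) i
      = (s i)⁻¹ * upperSum (ν.map fun v => v i) (q i) fun j => x j i := by
  have hm : Measurable fun v : EuclideanSpace ℝ (Fin d) => v i := by fun_prop
  rw [upperSum, map_measureReal_apply hm measurableSet_Ioi]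
  simp only [PiLp.smul_apply, WithLp.ofLp_sum, Finset.sum_apply, upperScore, smul_eq_mul]
  rw [← Finset.sum_div, div_eq_inv_mul]
  ring_nf
  rfl

/-! ### Coordinate-wise quantiles of vector arrays -/

section Array

variable {Ω Ω' : Type*} [MeasurableSpace Ω] [MeasurableSpace Ω'] {P : Measure Ω}
  [IsProbabilityMeasure P] {P' : Measure Ω'} [IsProbabilityMeasure P'] {d : ℕ} {k : ℕ → ℕ}
  {ζ : (n : ℕ) → Fin (k n) → Ω → EuclideanSpace ℝ (Fin d)}
  {G : ℕ → Ω → EuclideanSpace ℝ (Fin d)} {Y : Ω' → EuclideanSpace ℝ (Fin d)}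
  {α : Fin d → ℝ} {f : Fin d → ℝ → ℝ} {l : ℕ → ℕ} {T : ℕ → Ω → EuclideanSpace ℝ (Fin d)}

omit [IsProbabilityMeasure P] in
lemma cdf_map_coord {W : Ω → EuclideanSpace ℝ (Fin d)} (hW : AEMeasurable W P) (i : Fin d)
    (t : ℝ) : cdf ((P.map W).map fun v => v i) t = margCdf P W i t := by
  rw [margCdf, ← map_coord hW]

lemma tendsto_cdf_coord (hG : TendstoInDistribution G atTop Y (fun _ => P) P')
    (hf : ∀ i, IsDensity P' (fun ω => Y ω i) (f i)) (i : Fin d) (t : ℝ) :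
    Tendsto (fun n => cdf ((P.map (G n)).map fun v => v i) t) atTop (𝓝 (margCdf P' Y i t)) := by
  have hYm := hG.aemeasurable_limit
  have h := tendsto_real_coord_le hG.tendsto i (map_coord_eq_null_of_density hYm (hf i) t)
  rw [margCdf_eq_real hYm]
  refine h.congr fun n => ?_
  rw [cdf_map_coord (hG.forall_aemeasurable n), margCdf_eq_real (hG.forall_aemeasurable n)]
  rfl

omit [IsProbabilityMeasure P] in
lemma map_array_coord (hζm : ∀ n j, Measurable (ζ n j)) (hζl : ∀ n j, P.map (ζ n j) = P.map (G n))
    (i : Fin d) (n : ℕ) (j : Fin (k n)) :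
    P.map (fun ω => ζ n j ω i) = (P.map (G n)).map fun v => v i := by
  rw [← hζl n j, Measure.map_map (by fun_prop) (hζm n j)]
  rfl

omit [IsProbabilityMeasure P] in
lemma iIndepFun_array_coord (hζi : ∀ n, iIndepFun (ζ n) P) (i : Fin d) (n : ℕ) :
    iIndepFun (fun j ω => ζ n j ω i) P :=
  (hζi n).comp (fun _ v => v i) fun _ => by fun_prop

lemma isProbabilityMeasure_map_coord {W : Ω → EuclideanSpace ℝ (Fin d)} (hW : AEMeasurable W P)
    (i : Fin d) : IsProbabilityMeasure ((P.map W).map fun v => v i) := by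
  rw [map_coord hW]
  exact Measure.isProbabilityMeasure_map (aemeasurable_coord hW i)

lemma hasDerivAt_margCdf (hYm : AEMeasurable Y P') (hf : ∀ i, IsDensity P' (fun ω => Y ω i) (f i))
    (hfcont : ∀ i, ContinuousAt (f i) (margQuantile P' Y α i)) (i : Fin d) :
    HasDerivAt (margCdf P' Y i) (f i (margQuantile P' Y α i)) (margQuantile P' Y α i) := by
  have := Measure.isProbabilityMeasure_map (μ := P') (aemeasurable_coord hYm i)
  exact hasDerivAt_cdf (hf i).1 (hf i).2.1 (hf i).2.2 (hfcont i)

/-- Consistency of coordinate-wise quantiles of a triangular array. -/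
theorem tendstoInMeasure_array_quantile (hk : Tendsto k atTop atTop)
    (hζm : ∀ n j, Measurable (ζ n j)) (hζi : ∀ n, iIndepFun (ζ n) P)
    (hζl : ∀ n j, P.map (ζ n j) = P.map (G n))
    (hG : TendstoInDistribution G atTop Y (fun _ => P) P') (hα : ∀ i, α i ∈ Set.Ioo (0 : ℝ) 1)
    (hf : ∀ i, IsDensity P' (fun ω => Y ω i) (f i))
    (hfcont : ∀ i, ContinuousAt (f i) (margQuantile P' Y α i))
    (hfpos : ∀ i, 0 < f i (margQuantile P' Y α i))
    (hT : ∀ i, IsApproxQuantile P (fun n j ω => ζ n j ω i) l (α i) fun n ω => T n ω i)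
    (hl : Tendsto (fun n => (l n : ℝ) / k n) atTop (𝓝 0)) :
    TendstoInMeasure P T atTop fun _ => WithLp.toLp 2 (margQuantile P' Y α) := by
  have hYm := hG.aemeasurable_limit
  refine tendstoInMeasure_euclidean fun i => ?_
  have (n : ℕ) := isProbabilityMeasure_map_coord (hG.forall_aemeasurable n) i
  refine tendstoInMeasure_quantile hk (fun n j => ?_) (iIndepFun_array_coord hζi i)
    (map_array_coord hζm hζl i) (hT i) hl (tendsto_cdf_coord hG hf i)
    (fun t ht => cdf_lt_of_lt_quantileFn (hα i).1 ht) fun t ht => ?_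
  · have := hζm n j
    fun_prop
  · have h := lt_cdf_add (hasDerivAt_margCdf hYm hf hfcont i) (hfpos i) (sub_pos.2 ht)
    rw [add_sub_cancel] at h
    exact (margCdf_margQuantile hYm (hf i) (hα i)).symm.trans_lt h

/-- Centring with the law of `G n` itself makes every row exactly centred; only the covariance
varies with `n`, and it converges. -/
lemma tendstoInDistribution_upperScore {q s : Fin d → ℝ} (hk : Tendsto k atTop atTop)
    (hζm : ∀ n j, Measurable (ζ n j)) (hζi : ∀ n, iIndepFun (ζ n) P)
    (hζl : ∀ n j, P.map (ζ n j) = P.map (G n))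
    (hG : TendstoInDistribution G atTop Y (fun _ => P) P')
    (hnull : ∀ i, P'.map Y {v | v i = q i} = 0) :
    TendstoInDistribution (fun (n : ℕ) ω => (√(k n : ℝ))⁻¹ •
        ∑ j, upperScore (P.map (G n)) q s (ζ n j ω)) atTop id (fun _ => P)
      (multivariateGaussian 0 (upperCov (P'.map Y) q s)) := by
  have hν (n : ℕ) : IsProbabilityMeasure (P.map (G n)) :=
    Measure.isProbabilityMeasure_map (hG.forall_aemeasurable n)
  have hμ : IsProbabilityMeasure (P'.map Y) :=
    Measure.isProbabilityMeasure_map hG.aemeasurable_limit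
  have hsm (n : ℕ) : Measurable (upperScore (P.map (G n)) q s) := measurable_upperScore
  have hBν (n : ℕ) : IsProbabilityMeasure ((P.map (G n)).map (upperScore (P.map (G n)) q s)) :=
    Measure.isProbabilityMeasure_map (hsm n).aemeasurable
  have hinner (t : EuclideanSpace ℝ (Fin d)) :
      Measurable fun x : EuclideanSpace ℝ (Fin d) => inner ℝ x t := by fun_prop
  refine tendstoInDistribution_triangular hk
    (ν := fun n => (P.map (G n)).map (upperScore (P.map (G n)) q s))
    (C := √(∑ i, (1 / |s i|) ^ 2)) (fun n j => (hsm n).comp (hζm n j))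
    (fun n => (hζi n).comp (fun _ => upperScore (P.map (G n)) q s) fun _ => hsm n)
    (fun n j => ?_) (fun n => ?_) (fun n t => ?_) posSemidef_upperCov fun t => ?_
  · conv_rhs => rw [← hζl n j]
    rw [Measure.map_map (by rw [hζl]; exact hsm n) (hζm n j), hζl]
  · refine (ae_map_iff (hsm n).aemeasurable
      (measurableSet_le measurable_norm measurable_const)).2 (ae_of_all _ fun x => ?_)
    exact norm_upperScore_le x
  · rw [integral_map (hsm n).aemeasurable (hinner t).aestronglyMeasurable]
    exact integral_inner_upperScore t
  · have hcont : Continuous fun M : Matrix (Fin d) (Fin d) ℝ => t ⬝ᵥ M.mulVec t := by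
      fun_prop
    refine ((hcont.tendsto _).comp (tendsto_upperCov hG.tendsto hnull)).congr fun n => ?_
    rw [integral_map (hsm n).aemeasurable ((hinner t).pow_const 2).aestronglyMeasurable]
    exact (integral_inner_upperScore_sq (ν := P.map (G n)) t).symm

/-- Asymptotic normality of coordinate-wise quantiles of a triangular array. -/
theorem tendstoInDistribution_array_quantile (hk : Tendsto k atTop atTop)
    (hζm : ∀ n j, Measurable (ζ n j)) (hζi : ∀ n, iIndepFun (ζ n) P)
    (hζl : ∀ n j, P.map (ζ n j) = P.map (G n))
    (hG : TendstoInDistribution G atTop Y (fun _ => P) P') (hα : ∀ i, α i ∈ Set.Ioo (0 : ℝ) 1)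
    (hf : ∀ i, IsDensity P' (fun ω => Y ω i) (f i))
    (hfcont : ∀ i, ContinuousAt (f i) (margQuantile P' Y α i))
    (hfpos : ∀ i, 0 < f i (margQuantile P' Y α i))
    (hT : ∀ i, IsApproxQuantile P (fun n j ω => ζ n j ω i) l (α i) fun n ω => T n ω i)
    (hTm : ∀ n, AEMeasurable (T n) P)
    (hl : Tendsto (fun n => (l n : ℝ) / √(k n : ℝ)) atTop (𝓝 0)) {r R : ℕ → ℝ}
    (hr : Tendsto r atTop atTop) {κ : ℝ} (hκ : 0 < κ)
    (hkr : Tendsto (fun n => √(k n : ℝ) / r n) atTop (𝓝 κ))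
    (hRr : Tendsto (fun n => R n / r n) atTop (𝓝 κ))
    (hrate : ∀ i y, Tendsto (fun n => √(k n : ℝ) *
      (margCdf P' Y i (margQuantile P' Y α i + y / r n)
        - margCdf P (G n) i (margQuantile P' Y α i + y / r n))) atTop (𝓝 0)) :
    (asympCov P' Y f α).PosSemidef ∧
      TendstoInDistribution
        (fun n ω => R n • (T n ω - WithLp.toLp 2 (margQuantile P' Y α)))
        atTop id (fun _ => P) (multivariateGaussian 0 (asympCov P' Y f α)) := by
  have hYm := hG.aemeasurable_limit
  have hμ : IsProbabilityMeasure (P'.map Y) := Measure.isProbabilityMeasure_map hYm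
  rw [asympCov_eq_upperCov hYm hf hα]
  refine ⟨posSemidef_upperCov, ?_⟩
  refine tendstoInDistribution_of_tendstoInMeasure_sub _ _
    (tendstoInDistribution_upperScore hk hζm hζi hζl hG
      fun i => map_coord_eq_null_of_density hYm (hf i) _) ?_
    fun n => ((hTm n).sub_const _).const_smul (R n)
  refine tendstoInMeasure_euclidean fun i => ?_
  have (n : ℕ) := isProbabilityMeasure_map_coord (hG.forall_aemeasurable n) i
  have hξm (n : ℕ) (j : Fin (k n)) : Measurable fun ω => ζ n j ω i := by
    have := hζm n j
    fun_prop
  have hrate' := hrate i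
  simp_rw [← cdf_map_coord (hG.forall_aemeasurable _)] at hrate'
  have h := tendstoInMeasure_scaled_quantile_sub_upperSum hk hξm (iIndepFun_array_coord hζi i)
    (map_array_coord hζm hζl i) hr hκ hRr
    (tendstoInMeasure_quantile_sub_upperSum hk hξm (iIndepFun_array_coord hζi i)
      (map_array_coord hζm hζl i) (hT i) hl (margCdf_margQuantile hYm (hf i) (hα i))
      (hasDerivAt_margCdf hYm hf hfcont i) (hfpos i) hr hκ hkr hrate')
  refine h.congr_left fun n => ae_of_all _ fun ω => ?_
  simp only [Pi.sub_apply, PiLp.sub_apply]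
  rw [upperScore_sum_coord]
  rfl

end Array

end QoE

theorem mainTheorem1 {Ω Ω' E : Type*} [MeasurableSpace Ω] [MeasurableSpace Ω']
    [MeasurableSpace E] (P : Measure Ω) [IsProbabilityMeasure P]
    (P' : Measure Ω') [IsProbabilityMeasure P'] (d : ℕ)
    -- the i.i.d. observations
    (X : ℕ → Ω → E) (hXm : ∀ i, Measurable (X i)) (hXindep : iIndepFun X P)
    (hXident : ∀ i, IdentDistrib (X i) (X 0) P P)
    -- the initial estimator and its limit law
    (Z : (m : ℕ) → (Fin m → E) → EuclideanSpace ℝ (Fin d)) (hZ : ∀ m, Measurable (Z m))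
    (θ₀ : EuclideanSpace ℝ (Fin d)) (a : ℕ → ℝ) (ha0 : ∀ n, 0 ≤ a n)
    (ha : Tendsto a atTop atTop) (Y : Ω' → EuclideanSpace ℝ (Fin d))
    (hY : TendstoInDistribution (QoE.rescaled X Z θ₀ a) atTop Y (fun _ => P) P')
    (α : Fin d → ℝ) (hα : ∀ i, α i ∈ Set.Ioo (0 : ℝ) 1)
    -- the marginal densities
    (f : Fin d → ℝ → ℝ) (hf : ∀ i, QoE.IsDensity P' (fun ω => Y ω i) (f i))
    (hfcont : ∀ i, ContinuousAt (f i) (QoE.margQuantile P' Y α i))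
    (hfpos : ∀ i, 0 < f i (QoE.margQuantile P' Y α i))
    -- the contaminated sample, and the estimates from its blocks
    (l : ℕ → ℕ) (γ : ℝ)
    (hl : (fun n => (l n : ℝ)) =O[atTop] fun n : ℕ => (n : ℝ) ^ γ)
    (Xt : ℕ → ℕ → Ω → E) (hXt : QoE.IsContamination P X l Xt)
    (c : ℝ) (hc : 0 < c) (β : ℝ) (hβ : β ∈ Set.Ioo (0 : ℝ) 1)
    (Zt : (n : ℕ) → Fin (QoE.numBlocks c β n) → Ω → EuclideanSpace ℝ (Fin d))
    (hZt : ∀ n, QoE.IsBlockEstimate P X Z (Xt n) (QoE.numBlocks c β n)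
      (QoE.blockSize c β n) (Zt n)) :
    (γ < β →
      TendstoInMeasure P
        (fun n ω => a (QoE.blockSize c β n) •
          (QoE.compQuantile α (fun j => Zt n j ω) - θ₀))
        atTop (fun _ => WithLp.toLp 2 (QoE.margQuantile P' Y α))) ∧
    (2 * γ < β → (∀ i, β < QoE.betaStar P P' X Z θ₀ a Y α c i) →
      (QoE.asympCov P' Y f α).PosSemidef ∧
      TendstoInDistribution
        (fun (n : ℕ) ω => √(c * (n : ℝ) ^ β) •
          (a (QoE.blockSize c β n) • (QoE.compQuantile α (fun j => Zt n j ω) - θ₀)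
            - WithLp.toLp 2 (QoE.margQuantile P' Y α)))
        atTop id (fun _ => P) (multivariateGaussian 0 (QoE.asympCov P' Y f α))) := by
  have hk := QoE.tendsto_numBlocks_atTop hc hβ.1
  have hm := QoE.tendsto_blockSize_atTop hc hβ.2
  have hG : TendstoInDistribution (fun n => QoE.rescaled X Z θ₀ a (QoE.blockSize c β n)) atTop Y
      (fun _ => P) P' :=
    ⟨fun n => hY.forall_aemeasurable _, hY.aemeasurable_limit, hY.tendsto.comp hm⟩
  have hζm (n : ℕ) (j : Fin (QoE.numBlocks c β n)) :=
    QoE.measurable_rescaledBlock hXm hZ θ₀ a (QoE.blockSize c β n) j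
  have hζi (n : ℕ) := QoE.iIndepFun_rescaledBlock hXm hXindep hZ θ₀ a (QoE.numBlocks c β n)
    (QoE.blockSize c β n)
  have hζl (n : ℕ) (j : Fin (QoE.numBlocks c β n)) :=
    QoE.map_rescaledBlock hXm hXindep hXident hZ θ₀ a (QoE.blockSize c β n) j
  have hT := fun i => QoE.isApproxQuantile_of_isBlockEstimate hXt hc hβ hZt θ₀ ha (hα i) i
  refine ⟨fun hγ => ?_, fun hγ hβs => ?_⟩
  · exact QoE.tendstoInMeasure_array_quantile hk hζm hζi hζl hG hα hf hfcont hfpos hT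
      (QoE.tendsto_div_numBlocks hc hβ.1 hl hγ)
  -- The local rate is stated at `q + y / √⌊n^β⌋`, so `r n = √⌊n^β⌋`, while the theorem uses `R n =
  -- √(c n^β)`. Both `√k / r` and `R / r` tend to `κ = √c`.
  · refine QoE.tendstoInDistribution_array_quantile hk hζm hζi hζl hG hα hf hfcont hfpos hT
      (fun n => ?_) (QoE.tendsto_div_sqrt_numBlocks hc hβ.1 hl hγ)
      (QoE.tendsto_sqrt_floor_atTop hβ.1) (Real.sqrt_pos.2 hc)
      (QoE.tendsto_sqrt_numBlocks_div_sqrt_floor hc hβ.1)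
      (QoE.tendsto_sqrt_scale_div_sqrt_floor hc hβ.1)
      fun i y => (QoE.localRate_of_lt_betaStar hβ.1 (hβs i)).tendsto_sqrt_numBlocks hc hβ.1 y
    have hZtm : AEMeasurable (fun ω j => Zt n j ω) P :=
      aemeasurable_pi_lambda _ fun j => (hZt n j).1
    exact (((QoE.measurable_compQuantile α).comp_aemeasurable hZtm).sub_const θ₀).const_smul
      (a (QoE.blockSize c β n))
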